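/- Let $\mathsf H$ and $\mathsf K$ be complex Hilbert spaces. For $x\in\mathsf K$ let $E_x$ denote the operator $\zeta\mapsto\zeta\otimes x$ from $\mathsf H\otimes\mathsf K^{\otimes m}$ to $\mathsf H\otimes\mathsf K^{\otimes(m+1)}=(\mathsf H\otimes\mathsf K^{\otimes m})\otimes\mathsf K$ $(m\ge0$, $\mathsf K^{\otimes0}=\mathbb C)$, and let $E^x:=(E_x)^*$. Let $\mathcal A\subseteq B(\mathsf H)$ be a $C^*$-algebra (a norm-closed $*$-subalgebra, not necessarily unital). For a Hilbert space $\mathsf L$ write $\mathcal A\otimes_{\mathrm M}B(\mathsf L):=\{T\in B(\mathsf H\otimes\mathsf L): \tilde E^\xi T\tilde E_\eta\in\mathcal A\ \ \forall\,\xi,\eta\in\mathsf L\}$, where $\tilde E_\eta:\mathsf H\to\mathsf H\otimes\mathsf L$, $u\mapsto u\otimes\eta$, and $\tilde E^\xi:=(\tilde E_\xi)^*$. The spatial tensor product of operator spaces, $\otimes$, is the norm closure, and the ultraweak tensor product, $\mathop{\overline\otimes}$, is the ultraweak closure, of the algebraic tensor product acting on the Hilbert-space tensor product. Given $\phi:\mathcal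 A\to\mathcal A\otimes_{\mathrm M}B(\mathsf K)$, the quantum random walk with generator $\phi$ is the family of maps $\phi^{(m)}:\mathcal A\to\mathcal A\otimes_{\mathrm M}B(\mathsf K^{\otimes m})$, $m\ge0$, determined by $\phi^{(0)}(a)=a$ (with $\mathsf H\otimes\mathbb C$ identified with $\mathsf H$) and $$E^x\,\phi^{(m)}(a)\,E_y=\phi^{(m-1)}\bigl(E^x\phi(a)E_y\bigr)\qquad\forall\,x,y\in\mathsf K,\ a\in\mathcal A,\ m\ge1.$$ (i) If $\phi:\mathcal A\to\mathcal A\otimes B(\mathsf K)$ is a $*$-homomorphism, then the family $(\phi^{(m)})_{m\ge0}$ exists and is unique, and for all $m\ge0$ the map $\phi^{(m)}$ is a $*$-homomorphism from $\mathcal A$ into $\mathcal A\otimes B(\mathsf K)^{\otimes m}$. (ii) If $\mathcal A$ is a von Neumann algebra and $\phi:\mathcal A\to\mathcal A\mathop{\overline\otimes}B(\mathsf K)$ is a normal (i.e. ultraweakly continuous) $*$-homomorphism, not necessarily unital, then the family $(\phi^{(m)})_{m\ge0}$ exists and is unique, and for all $m\ge0$ the map $\phi^{(m)}$ is a normal $*$-homomorphism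 from $\mathcal A$ into $\mathcal A\mathop{\overline\otimes}B(\mathsf K^{\otimes m})$. In both cases every $\phi^{(m)}$ $(m\ge0)$ is completely bounded: the maps $a\otimes b\mapsto\phi^{(m)}(a)\otimes b$ on $\mathcal A\odot B(\mathbb C^n)$ are bounded uniformly in $n\ge1$. -/

import Mathlib

open scoped TensorProduct

noncomputable section

universe u v

/-! ### Hilbert-space tensor products and tensor powers -/

/-- The Hilbert-space tensor product `H ⊗ K`: the completion of the algebraic tensor product for
the inner product with `⟪u ⊗ x, v ⊗ y⟫ = ⟪u, v⟫ ⟪x, y⟫`. -/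
abbrev HilbTensor (H : Type u) (K : Type v)
    [NormedAddCommGroup H] [InnerProductSpace ℂ H]
    [NormedAddCommGroup K] [InnerProductSpace ℂ K] : Type (max u v) :=
  UniformSpace.Completion (H ⊗[ℂ] K)

/-- The tensor product `a ⊗ b` of bounded operators, the bounded operator with
`(a ⊗ b) (u ⊗ x) = a u ⊗ b x`. -/
def opTensor {H₁ H₂ K₁ K₂ : Type*}
    [NormedAddCommGroup H₁] [InnerProductSpace ℂ H₁]
    [NormedAddCommGroup H₂] [InnerProductSpace ℂ H₂]
    [NormedAddCommGroup K₁] [InnerProductSpace ℂ K₁]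
    [NormedAddCommGroup K₂] [InnerProductSpace ℂ K₂]
    (a : H₁ →L[ℂ] H₂) (b : K₁ →L[ℂ] K₂) : HilbTensor H₁ K₁ →L[ℂ] HilbTensor H₂ K₂ :=
  (TensorProduct.mapL a b).completion

/-- The operator `E_x : H → H ⊗ K`, `u ↦ u ⊗ x`. -/
def ketE (H : Type*) {K : Type*}
    [NormedAddCommGroup H] [InnerProductSpace ℂ H]
    [NormedAddCommGroup K] [InnerProductSpace ℂ K] (x : K) : H →L[ℂ] HilbTensor H K :=
  UniformSpace.Completion.toComplL ∘L (TensorProduct.mkL ℂ H K).flip x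

/-- A bundled complex Hilbert space (used only to define tensor powers by recursion). -/
structure HilbertBundle : Type (v + 1) where
  carrier : Type v
  [group : NormedAddCommGroup carrier]
  [inner : InnerProductSpace ℂ carrier]
  [complete : CompleteSpace carrier]

attribute [instance] HilbertBundle.group HilbertBundle.inner HilbertBundle.complete

/-- `K^{⊗ 0}` is the one-dimensional space `ℂ` (as functions on a point, so as to live in the
universe of `K`), and `K^{⊗ (m+1)} = K^{⊗ m} ⊗ K`. -/
def tensorPowBundle (K : Type v) [NormedAddCommGroup K] [InnerProductSpace ℂ K] :
    ℕ → HilbertBundle.{v}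
  | 0 => { carrier := EuclideanSpace ℂ PUnit.{v + 1} }
  | m + 1 => { carrier := HilbTensor (tensorPowBundle K m).carrier K }

/-- The Hilbert-space tensor power `K^{⊗ m}`. -/
abbrev TensorPow (K : Type v) [NormedAddCommGroup K] [InnerProductSpace ℂ K] (m : ℕ) : Type v :=
  (tensorPowBundle K m).carrier

/-- The operator `K^{⊗ m} → K^{⊗ (m+1)} = K^{⊗ m} ⊗ K`, `ξ ↦ ξ ⊗ x`. -/
def snocTensor {K : Type v} [NormedAddCommGroup K] [InnerProductSpace ℂ K] (m : ℕ) (x : K) :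
    TensorPow K m →L[ℂ] TensorPow K (m + 1) :=
  (ketE (TensorPow K m) x : TensorPow K m →L[ℂ] HilbTensor (TensorPow K m) K)

/-- The operator `E_x : H ⊗ K^{⊗ m} → H ⊗ K^{⊗ (m+1)}`, `u ⊗ ξ ↦ u ⊗ (ξ ⊗ x)`; this is
`ζ ↦ ζ ⊗ x` under the identification of `H ⊗ K^{⊗ (m+1)}` with `(H ⊗ K^{⊗ m}) ⊗ K`. -/
def ketEPow (H : Type u) {K : Type v}
    [NormedAddCommGroup H] [InnerProductSpace ℂ H]
    [NormedAddCommGroup K] [InnerProductSpace ℂ K] (m : ℕ) (x : K) :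
    HilbTensor H (TensorPow K m) →L[ℂ] HilbTensor H (TensorPow K (m + 1)) :=
  opTensor (ContinuousLinearMap.id ℂ H) (snocTensor m x)

/-! ### Operator spaces: spatial and ultraweak tensor products, matrix spaces -/

section OperatorSpaces

variable {H : Type u} {K : Type v}
  [NormedAddCommGroup H] [InnerProductSpace ℂ H]
  [NormedAddCommGroup K] [InnerProductSpace ℂ K]

/-- The linear span of the operators `a ⊗ b` with `a ∈ V`, `b ∈ W`: the algebraic tensor product
of the operator spaces `V` and `W`, realised in `B(H ⊗ K)`. -/
def algTensor (V : Set (H →L[ℂ] H)) (W : Set (K →L[ℂ] K)) :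
    Submodule ℂ (HilbTensor H K →L[ℂ] HilbTensor H K) :=
  Submodule.span ℂ (Set.image2 opTensor V W)

/-- The spatial tensor product `V ⊗ W`: the norm closure of the algebraic tensor product in
`B(H ⊗ K)`. -/
def spatialTensor (V : Set (H →L[ℂ] H)) (W : Set (K →L[ℂ] K)) :
    Submodule ℂ (HilbTensor H K →L[ℂ] HilbTensor H K) :=
  (algTensor V W).topologicalClosure

/-- The ultraweak (σ-weak) topology on `B(H)`: the coarsest topology making all the functionals
`T ↦ ∑ₙ ⟪xₙ, T yₙ⟫` continuous, where `∑ₙ ‖xₙ‖² < ∞` and `∑ₙ ‖yₙ‖² < ∞`. -/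
abbrev ultraweakTopology (H : Type u) [NormedAddCommGroup H] [InnerProductSpace ℂ H] :
    TopologicalSpace (H →L[ℂ] H) :=
  ⨅ (x : ℕ → H) (y : ℕ → H) (_ : Summable fun n => ‖x n‖ ^ 2) (_ : Summable fun n => ‖y n‖ ^ 2),
    TopologicalSpace.induced (fun T : H →L[ℂ] H => ∑' n, inner ℂ (x n) (T (y n))) inferInstance

/-- The ultraweak tensor product of `V` and `W`: the ultraweak closure of the algebraic tensor
product in `B(H ⊗ K)`. -/
def ultraweakTensor (V : Set (H →L[ℂ] H)) (W : Set (K →L[ℂ] K)) :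
    Set (HilbTensor H K →L[ℂ] HilbTensor H K) :=
  @closure _ (ultraweakTopology (HilbTensor H K)) (algTensor V W)

/-- The iterated spatial tensor product `B(K)^{⊗ m} ⊆ B(K^{⊗ m})`. -/
def spatialPow (K : Type v) [NormedAddCommGroup K] [InnerProductSpace ℂ K] :
    (m : ℕ) → Submodule ℂ (TensorPow K m →L[ℂ] TensorPow K m)
  | 0 => ⊤
  | m + 1 => spatialTensor (spatialPow K m : Set (TensorPow K m →L[ℂ] TensorPow K m))
      (Set.univ : Set (K →L[ℂ] K))

/-- The matrix space over `V`: all `T ∈ B(H ⊗ K)` with `E^x T E_y ∈ V` for all `x, y ∈ K`, where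
`E^x` is the adjoint of `E_x`. -/
def matrixSpace [CompleteSpace H] (K : Type v) [NormedAddCommGroup K] [InnerProductSpace ℂ K]
    (V : Set (H →L[ℂ] H)) : Set (HilbTensor H K →L[ℂ] HilbTensor H K) :=
  {T | ∀ x y : K, (ketE H x).adjoint ∘L T ∘L ketE H y ∈ V}

/-- `(Φ m)` is the quantum random walk with generator `φ`, where `φ` maps `V` into the matrix space
over `V`: the map `Φ m` takes `V` into the matrix space in `B(H ⊗ K^{⊗ m})` over `V`, the map `Φ 0`
is the identity (`a ↦ a ⊗ 1` on `H ⊗ ℂ`), and `E^x Φ_{m+1}(a) E_y = Φ_m (E^x φ(a) E_y)`. -/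
structure IsQuantumRandomWalk [CompleteSpace H] {S : Type*} [SetLike S (H →L[ℂ] H)] (V : S)
    (φ : V → matrixSpace K (V : Set (H →L[ℂ] H)))
    (Φ : (m : ℕ) → V → (HilbTensor H (TensorPow K m) →L[ℂ] HilbTensor H (TensorPow K m))) :
    Prop where
  mem (m : ℕ) (a : V) : Φ m a ∈ matrixSpace (TensorPow K m) (V : Set (H →L[ℂ] H))
  zero (a : V) : Φ 0 a = opTensor (a : H →L[ℂ] H) 1
  succ (m : ℕ) (a : V) (x y : K) :
    (ketEPow H m x).adjoint ∘L Φ (m + 1) a ∘L ketEPow H m y =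
      Φ m ⟨(ketE H x).adjoint ∘L (φ a : HilbTensor H K →L[ℂ] HilbTensor H K) ∘L ketE H y,
        (φ a).2 x y⟩

end OperatorSpaces

/-- A linear map `φ` from the operator space `V ⊆ B(H₁)` to `B(H₂)` is completely bounded if the
maps `a ⊗ b ↦ φ a ⊗ b` on the algebraic tensor products `V ⊙ B(ℂⁿ) ⊆ B(H₁ ⊗ ℂⁿ)` are bounded,
uniformly in `n`. -/
def IsCompletelyBounded {H₁ H₂ : Type*}
    [NormedAddCommGroup H₁] [InnerProductSpace ℂ H₁]
    [NormedAddCommGroup H₂] [InnerProductSpace ℂ H₂]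
    {S : Type*} [SetLike S (H₁ →L[ℂ] H₁)] (V : S) (φ : V → (H₂ →L[ℂ] H₂)) : Prop :=
  ∃ C : ℝ, ∀ (n k : ℕ) (a : Fin k → V)
    (b : Fin k → (EuclideanSpace ℂ (Fin n) →L[ℂ] EuclideanSpace ℂ (Fin n))),
    ‖∑ i, opTensor (φ (a i)) (b i)‖ ≤ C * ‖∑ i, opTensor (a i : H₁ →L[ℂ] H₁) (b i)‖

/-- A map `φ` from `V ⊆ B(H₁)` to `B(H₂)` is normal if it is continuous for the (relative)
ultraweak topologies. -/
def IsNormalMap {H₁ H₂ : Type*}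
    [NormedAddCommGroup H₁] [InnerProductSpace ℂ H₁]
    [NormedAddCommGroup H₂] [InnerProductSpace ℂ H₂]
    {S : Type*} [SetLike S (H₁ →L[ℂ] H₁)] (V : S) (φ : V → (H₂ →L[ℂ] H₂)) : Prop :=
  @Continuous V (H₂ →L[ℂ] H₂)
    (TopologicalSpace.induced (fun a : V => (a : H₁ →L[ℂ] H₁)) (ultraweakTopology H₁))
    (ultraweakTopology H₂) φ

/-! ### The spatial and ultraweak tensor products lie in the matrix space -/

section Inclusions

variable {H : Type u} {K : Type v}
  [NormedAddCommGroup H] [InnerProductSpace ℂ H]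
  [NormedAddCommGroup K] [InnerProductSpace ℂ K]

theorem opTensor_ketE (a : H →L[ℂ] H) (b : K →L[ℂ] K) (y : K) (w : H) :
    opTensor a b (ketE H y w) = ketE H (b y) (a w) := by
  simp [opTensor, ketE, ContinuousLinearMap.completion_apply_coe]

theorem inner_ketE (x y : K) (w z : H) :
    inner ℂ (ketE H x w) (ketE H y z) = inner ℂ w z * inner ℂ x y := by
  simp [ketE, UniformSpace.Completion.inner_coe]

theorem adjoint_opTensor_ketE [CompleteSpace H] (a : H →L[ℂ] H) (b : K →L[ℂ] K) (x y : K) :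
    (ketE H x).adjoint ∘L opTensor a b ∘L ketE H y = (inner ℂ x (b y) : ℂ) • a := by
  ext w
  refine ext_inner_left ℂ fun z => ?_
  simp [ContinuousLinearMap.adjoint_inner_right, opTensor_ketE, inner_ketE, inner_smul_right,
    mul_comm]

theorem spatialTensor_subset_matrixSpace [CompleteSpace H]
    (A : NonUnitalStarSubalgebra ℂ (H →L[ℂ] H)) (hA : IsClosed (A : Set (H →L[ℂ] H)))
    {T : HilbTensor H K →L[ℂ] HilbTensor H K}
    (hT : T ∈ spatialTensor (A : Set (H →L[ℂ] H)) (Set.univ : Set (K →L[ℂ] K))) :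
    T ∈ matrixSpace K (A : Set (H →L[ℂ] H)) := by
  intro x y
  have hcont : Continuous fun T : HilbTensor H K →L[ℂ] HilbTensor H K =>
      (ketE H x).adjoint ∘L T ∘L ketE H y := by fun_prop
  have hclosed := hA.preimage hcont
  have hsub : (algTensor (A : Set (H →L[ℂ] H)) (Set.univ : Set (K →L[ℂ] K)) : Set _) ⊆
      (fun T : HilbTensor H K →L[ℂ] HilbTensor H K =>
        (ketE H x).adjoint ∘L T ∘L ketE H y) ⁻¹' (A : Set (H →L[ℂ] H)) := by
    intro S hS
    induction hS using Submodule.span_induction with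
    | mem S hS =>
      obtain ⟨a, ha, b, -, rfl⟩ := hS
      simpa [adjoint_opTensor_ketE] using SMulMemClass.smul_mem _ ha
    | zero => simp
    | add S T _ _ hS hT =>
      simpa [ContinuousLinearMap.comp_add, ContinuousLinearMap.add_comp] using add_mem hS hT
    | smul c S _ hS =>
      simpa [ContinuousLinearMap.comp_smul, ContinuousLinearMap.smul_comp] using
        SMulMemClass.smul_mem c hS
  exact closure_minimal hsub hclosed hT

theorem continuous_ultraweak_inner (x y : H) :
    @Continuous (H →L[ℂ] H) ℂ (ultraweakTopology H) inferInstance (fun T => inner ℂ x (T y)) := by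
  have hs : ∀ z : H, Summable fun n : ℕ => ‖(if n = 0 then z else 0 : H)‖ ^ 2 := fun z =>
    summable_of_ne_finset_zero (s := {0}) fun n hn => by
      have : n ≠ 0 := by simpa using hn
      simp [this]
  have hle : ultraweakTopology H ≤
      TopologicalSpace.induced (fun T : H →L[ℂ] H => (inner ℂ x (T y) : ℂ)) inferInstance := by
    refine (iInf_le_of_le (fun n : ℕ => if n = 0 then x else 0) <|
      iInf_le_of_le (fun n : ℕ => if n = 0 then y else 0) <|
      iInf_le_of_le (hs x) <| iInf_le_of_le (hs y) ?_)
    refine le_of_eq ?_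
    congr 1
    funext T
    rw [tsum_eq_single 0 fun n hn => by simp [hn]]
    simp
  exact continuous_iff_le_induced.2 hle

theorem ultraweakTensor_subset_matrixSpace [CompleteSpace H] (A : VonNeumannAlgebra H)
    {T : HilbTensor H K →L[ℂ] HilbTensor H K}
    (hT : T ∈ ultraweakTensor (A : Set (H →L[ℂ] H)) (Set.univ : Set (K →L[ℂ] K))) :
    T ∈ matrixSpace K (A : Set (H →L[ℂ] H)) := by
  intro x y
  rw [← A.centralizer_centralizer, Set.mem_centralizer_iff]
  intro c hc
  rw [Set.mem_centralizer_iff] at hc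
  ext w
  refine ext_inner_left ℂ fun z => ?_
  have key : ∀ T : HilbTensor H K →L[ℂ] HilbTensor H K,
      T ∈ ultraweakTensor (A : Set (H →L[ℂ] H)) (Set.univ : Set (K →L[ℂ] K)) →
      (inner ℂ (ketE H x (c.adjoint z)) (T (ketE H y w)) : ℂ) =
        inner ℂ (ketE H x z) (T (ketE H y (c w))) := by
    intro T hT
    let _ := ultraweakTopology (HilbTensor H K)
    have hclosed : IsClosed {T : HilbTensor H K →L[ℂ] HilbTensor H K |
        (inner ℂ (ketE H x (c.adjoint z)) (T (ketE H y w)) : ℂ) =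
          inner ℂ (ketE H x z) (T (ketE H y (c w)))} :=
      isClosed_eq (continuous_ultraweak_inner _ _) (continuous_ultraweak_inner _ _)
    refine closure_minimal ?_ hclosed hT
    intro S hS
    simp only [Set.mem_ofPred_eq]
    induction hS using Submodule.span_induction with
    | mem S hS =>
      obtain ⟨a, ha, b, -, rfl⟩ := hS
      have hac : a (c w) = c (a w) := congrArg (fun f : H →L[ℂ] H => f w) (hc a ha)
      simp [opTensor_ketE, inner_ketE, ContinuousLinearMap.adjoint_inner_left, hac]
    | zero => simp
    | add S T _ _ hS hT => simp [inner_add_right, hS, hT]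
    | smul r S _ hS => simp [inner_smul_right, hS]
  have h := key T hT
  simp only [mul_apply_eq_comp, ContinuousLinearMap.comp_apply,
    ContinuousLinearMap.adjoint_inner_right]
  rw [← h, ← ContinuousLinearMap.adjoint_inner_left, ContinuousLinearMap.adjoint_inner_right]

end Inclusions

end

/-!
A quantum random walk is obtained by iterating one construction. Suppose that `Y` is the Hilbert
tensor product `X ⊗ K`, presented by the operators `E x : u ↦ u ⊗ x` (`IsKet`), let `π` be a
representation of the C*-algebra `𝒜 ⊆ B(H)` on `X`, and let `T ∈ B(H ⊗ K)` have all its slices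
`E^x T E_y` in `𝒜`. Then `S = (π ⊗ id)(T) ∈ B(X ⊗ K)` is the operator with slices `π (E^x T E_y)`
(`IsAmpliation`). With `X = H ⊗ K^{⊗ m}` and `Y = H ⊗ K^{⊗ (m+1)}`, the recursion for the walk says
exactly that `φ^{(m+1)}(a)` is the ampliation of `φ(a)` along `φ^{(m)}`. Operators are determined by
their slices, so the walk is unique, and there remain the existence of ampliations and the
properties that ampliation preserves.

*Existence.* For a finite set `F` of basis vectors of `K`, the corner of `T` at `F` is a matrix in
`M_F(𝒜)`, represented isometrically on `H ⊗ K`; applying `π` entrywise to it is contractive, as a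
`*`-homomorphism of C*-algebras (`norm_matrixRep_le`). The resulting net of operators is bounded,
and its weak limit points are ampliations of `T` (`IsAmpliation.exists_of_slices`). For the same
reason ampliation is contractive (`IsAmpliation.norm_le`), which also gives complete boundedness
(`norm_sum_opTensor_le`).

*The spatial case.* Ampliation is linear and `*`-preserving. It is multiplicative on `𝒜 ⊙ B(K)`,
hence on its norm closure (`IsAmpliation.mul_of_mem_spatialTensor`), and contractivity shows that it
carries `𝒜 ⊗ B(K)` into `𝒜 ⊗ B(K)^{⊗ (m+1)}` (`IsAmpliation.mem_spatialTensor`).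

*The normal case.* If `π` is normal, multiplicativity follows on inserting the finite projections
`1 ⊗ P_F` between two factors, since `E^x T (1 ⊗ P_F) T' E_y` converges ultraweakly
(`IsAmpliation.mul_of_isNormalRep`). It has to be shown that the ampliation `Φ` of a normal `φ`
along `π` is normal again (`IsNormalRep.of_isAmpliation`). Its diagonal coefficients at the total
set of vectors `E x u` are normal. A normal positive functional is dominated by a vector functional
in the amplification `H ⊗ ℓ²`; if `W` is the corresponding intertwiner, the functional is then the
vector functional of `|W| z` (`exists_vector_of_dominated`), so that all coefficients of the vector
factor through `H ⊗ ℓ²`, with norm control. This makes the vectors with normal coefficients a closed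
subspace (`isClosed_normalVectors`), which must be everything. Finally, an operator in the matrix
space over `𝒜` is the ultraweak limit of its finite corners, which lie in `𝒜 ⊙ B(K)`
(`matrixSpace_subset_ultraweakTensor`).
-/

noncomputable section

open Filter Topology
open scoped InnerProductSpace

/-! ### Ket families -/

section Kets

variable {K X Y : Type*}
  [NormedAddCommGroup K] [InnerProductSpace ℂ K]
  [NormedAddCommGroup X] [InnerProductSpace ℂ X]
  [NormedAddCommGroup Y] [InnerProductSpace ℂ Y]

/-- A family of operators `E x : X → Y`, `x ∈ K`, that exhibits `Y` as the Hilbert-space tensor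
product `X ⊗ K`, with `E x u` in the role of `u ⊗ x`. Only the inner products and totality are
required; linearity in `x` follows from these. -/
structure IsKet (E : K → X →L[ℂ] Y) : Prop where
  inner_eq (x y : K) (u v : X) : ⟪E x u, E y v⟫_ℂ = ⟪u, v⟫_ℂ * ⟪x, y⟫_ℂ
  total (w : Y) (hw : ∀ x u, ⟪E x u, w⟫_ℂ = 0) : w = 0

namespace IsKet

variable {E : K → X →L[ℂ] Y} (hE : IsKet E)
include hE

theorem eq_of_inner {w w' : Y} (h : ∀ x u, ⟪E x u, w⟫_ℂ = ⟪E x u, w'⟫_ℂ) : w = w' :=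
  sub_eq_zero.1 <| hE.total _ fun x u => by rw [inner_sub_right, h, sub_self]

theorem map_add (x y : K) : E (x + y) = E x + E y := by
  ext u
  refine hE.eq_of_inner fun z v => ?_
  simp [hE.inner_eq, mul_add]

theorem map_smul (c : ℂ) (x : K) : E (c • x) = c • E x := by
  ext u
  refine hE.eq_of_inner fun z v => ?_
  simp only [smul_apply, inner_smul_right, hE.inner_eq]
  ring

theorem norm_apply (x : K) (u : X) : ‖E x u‖ = ‖x‖ * ‖u‖ := by
  have h := hE.inner_eq x x u u
  rw [inner_self_eq_norm_sq_to_K, inner_self_eq_norm_sq_to_K, inner_self_eq_norm_sq_to_K] at h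
  have h' : ‖E x u‖ ^ 2 = (‖x‖ * ‖u‖) ^ 2 := by
    rw [mul_pow, mul_comm]; exact_mod_cast h
  exact (pow_left_inj₀ (norm_nonneg _) (by positivity) two_ne_zero).1 h'

/-- For fixed `u`, the bounded operator `x ↦ E x u`. -/
def flip (u : X) : K →L[ℂ] Y :=
  LinearMap.mkContinuous
    { toFun := fun x => E x u
      map_add' := fun x y => by rw [hE.map_add]; rfl
      map_smul' := fun c x => by rw [hE.map_smul]; rfl } ‖u‖
    fun x => by simp [hE.norm_apply, mul_comm]

@[simp] theorem flip_apply (u : X) (x : K) : hE.flip u x = E x u := rfl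

theorem map_finsetSum {κ : Type*} (F : Finset κ) (x : κ → K) :
    E (∑ i ∈ F, x i) = ∑ i ∈ F, E (x i) := by
  ext u
  rw [← hE.flip_apply, map_sum]
  simp

theorem continuous : Continuous E := by
  have hlip : LipschitzWith 1 E := by
    refine LipschitzWith.of_dist_le_mul fun x y => ?_
    rw [dist_eq_norm, dist_eq_norm, NNReal.coe_one, one_mul]
    refine ContinuousLinearMap.opNorm_le_bound _ (norm_nonneg _) fun u => ?_
    rw [sub_apply, ← hE.flip_apply, ← hE.flip_apply, ← _root_.map_sub,
      hE.flip_apply, hE.norm_apply]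
  exact hlip.continuous

/-- `E x` as a linear isometry, for a unit vector `x`. -/
def isometry (x : K) (hx : ‖x‖ = 1) : X →ₗᵢ[ℂ] Y where
  toLinearMap := (E x).toLinearMap
  norm_map' u := by simp [hE.norm_apply, hx]

@[simp] theorem isometry_apply (x : K) (hx : ‖x‖ = 1) (u : X) : hE.isometry x hx u = E x u := rfl

variable [CompleteSpace X] [CompleteSpace Y] [CompleteSpace K]

omit [CompleteSpace K] in
theorem adjoint_apply (x y : K) (u : X) : (E x).adjoint (E y u) = ⟪x, y⟫_ℂ • u := by
  refine ext_inner_left ℂ fun v => ?_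
  rw [ContinuousLinearMap.adjoint_inner_right, hE.inner_eq, inner_smul_right, mul_comm]

omit [CompleteSpace K] in
theorem ext_vec {w w' : Y} (h : ∀ x, (E x).adjoint w = (E x).adjoint w') : w = w' :=
  hE.eq_of_inner fun x u => by
    rw [← ContinuousLinearMap.adjoint_inner_right, h, ContinuousLinearMap.adjoint_inner_right]

omit [CompleteSpace X] [CompleteSpace K] in
theorem dense_span : (⨆ x, (E x).range).topologicalClosure = ⊤ := by
  rw [Submodule.topologicalClosure_eq_top_iff, Submodule.eq_bot_iff]
  intro w hw
  refine hE.total w fun x u => ?_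
  exact (Submodule.mem_orthogonal _ _).1 hw _ (Submodule.mem_iSup_of_mem x ⟨u, rfl⟩)

omit [CompleteSpace X] [CompleteSpace K] in
theorem ext_comp {Z : Type*} [NormedAddCommGroup Z] [NormedSpace ℂ Z] {S S' : Y →L[ℂ] Z}
    (h : ∀ x, S ∘L E x = S' ∘L E x) : S = S' := by
  have hle : (⨆ x, (E x).range) ≤ (S - S').ker := by
    refine iSup_le fun x => ?_
    rintro _ ⟨u, rfl⟩
    have := congrArg (fun f => f u) (h x)
    simpa [sub_eq_zero] using this
  have htop : (⨆ x, (E x).range).topologicalClosure ≤ (S - S').ker :=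
    Submodule.topologicalClosure_minimal _ hle (S - S').isClosed_ker
  rw [hE.dense_span] at htop
  ext w
  have : w ∈ (S - S').ker := htop Submodule.mem_top
  simpa [sub_eq_zero] using this

omit [CompleteSpace K] in
/-- An operator on `X ⊗ K` is determined by its slices `E^x S E_y`. -/
theorem ext_op {S S' : Y →L[ℂ] Y}
    (h : ∀ x y, (E x).adjoint ∘L S ∘L E y = (E x).adjoint ∘L S' ∘L E y) : S = S' := by
  refine hE.ext_comp fun y => ?_
  ext u
  exact hE.ext_vec fun x => congrArg (fun f => f u) (h x y)

section Basis

variable {κ : Type*} (b : HilbertBasis κ ℂ K)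

omit [CompleteSpace X] [CompleteSpace Y] [CompleteSpace K] in
theorem orthogonalFamily :
    OrthogonalFamily ℂ (fun _ : κ => X) fun i =>
      hE.isometry (b i) (b.orthonormal.norm_eq_one i) := by
  intro i j hij u v
  simp [hE.inner_eq, b.orthonormal.inner_eq_zero hij]

/-- `X ⊗ K` is the Hilbert sum of the copies `E (bᵢ) X` of `X`: a vector orthogonal to all of them
is orthogonal to `E x u` for every `x`, by expanding `x` in the basis. -/
theorem isHilbertSum :
    IsHilbertSum ℂ (fun _ : κ => X) fun i =>
      hE.isometry (b i) (b.orthonormal.norm_eq_one i) := by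
  refine IsHilbertSum.mk (hE.orthogonalFamily b) (le_of_eq ?_)
  symm
  rw [Submodule.topologicalClosure_eq_top_iff, Submodule.eq_bot_iff]
  intro w hw
  refine hE.total w fun x u => ?_
  rw [← hE.flip_apply, ← ContinuousLinearMap.adjoint_inner_right]
  have h0 : (hE.flip u).adjoint w = 0 := by
    rw [← b.repr.map_eq_zero_iff]
    ext i
    rw [b.repr_apply_apply, ContinuousLinearMap.adjoint_inner_right]
    exact (Submodule.mem_orthogonal _ _).1 hw _ (Submodule.mem_iSup_of_mem i ⟨u, rfl⟩)
  rw [h0, inner_zero_right]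

omit [CompleteSpace K] in
open scoped Classical in
theorem coord_eq_of_hasSum {x : κ → X} {w : Y} (h : HasSum (fun i => E (b i) (x i)) w) (j : κ) :
    (E (b j)).adjoint w = x j := by
  refine (h.mapL (E (b j)).adjoint).unique ?_
  have h2 : ∀ i, (E (b j)).adjoint (E (b i) (x i)) = if i = j then x j else 0 := by
    intro i
    rw [hE.adjoint_apply]
    split_ifs with hij
    · subst hij; simp [b.orthonormal.norm_eq_one i]
    · rw [b.orthonormal.inner_eq_zero (Ne.symm hij), zero_smul]
  simp_rw [h2]
  exact hasSum_ite_eq j _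

theorem hasSum_coord (w : Y) : HasSum (fun i => E (b i) ((E (b i)).adjoint w)) w := by
  have h := (hE.isHilbertSum b).hasSum_linearIsometryEquiv_symm
    ((hE.isHilbertSum b).linearIsometryEquiv w)
  rw [LinearIsometryEquiv.symm_apply_apply] at h
  simp only [isometry_apply] at h
  simpa only [hE.coord_eq_of_hasSum b h] using h

theorem hasSum_inner_coord (w w' : Y) :
    HasSum (fun i => ⟪(E (b i)).adjoint w, (E (b i)).adjoint w'⟫_ℂ) ⟪w, w'⟫_ℂ := by
  have h := (hE.hasSum_coord b w').mapL (innerSL ℂ w)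
  simpa [ContinuousLinearMap.adjoint_inner_left] using h

theorem hasSum_norm_sq_coord (w : Y) :
    HasSum (fun i => ‖(E (b i)).adjoint w‖ ^ 2) (‖w‖ ^ 2) := by
  have h := (hE.hasSum_inner_coord b w w).mapL Complex.reCLM
  simp only [inner_self_eq_norm_sq_to_K] at h
  exact_mod_cast h

omit [CompleteSpace K] in
theorem exists_coord_eq (x : κ → X) (hx : Summable fun i => ‖x i‖ ^ 2) :
    ∃ w : Y, ∀ i, (E (b i)).adjoint w = x i := by
  obtain ⟨w, hw⟩ := ((hE.orthogonalFamily b).summable_iff_norm_sq_summable x).2 hx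
  exact ⟨w, hE.coord_eq_of_hasSum b hw⟩

end Basis

end IsKet

/-- The projection `∑_{i ∈ F} E_{bᵢ} E^{bᵢ}` of `X ⊗ K` onto `X ⊗ span {bᵢ | i ∈ F}`. -/
def ketProj [CompleteSpace X] [CompleteSpace Y] (E : K → X →L[ℂ] Y) {κ : Type*}
    (b : HilbertBasis κ ℂ K) (F : Finset κ) : Y →L[ℂ] Y :=
  ∑ i ∈ F, E (b i) ∘L (E (b i)).adjoint

namespace IsKet

variable {E : K → X →L[ℂ] Y} (hE : IsKet E) [CompleteSpace X] [CompleteSpace Y] [CompleteSpace K]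
  {κ : Type*} (b : HilbertBasis κ ℂ K)
include hE

theorem tendsto_ketProj (w : Y) :
    Tendsto (fun F => ketProj E b F w) atTop (𝓝 w) := by
  have h : Tendsto _ _ _ := hE.hasSum_coord b w
  simpa [ketProj, SummationFilter.unconditional] using h

theorem norm_ketProj_apply_le (F : Finset κ) (w : Y) : ‖ketProj E b F w‖ ≤ ‖w‖ := by
  have hsq : ‖ketProj E b F w‖ ^ 2 = ∑ i ∈ F, ‖(E (b i)).adjoint w‖ ^ 2 := by
    have := (hE.orthogonalFamily b).norm_sum (fun i => (E (b i)).adjoint w) F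
    simpa [ketProj] using this
  have hle : ‖ketProj E b F w‖ ^ 2 ≤ ‖w‖ ^ 2 := by
    rw [hsq]
    exact sum_le_hasSum F (fun i _ => by positivity) (hE.hasSum_norm_sq_coord b w)
  exact (pow_le_pow_iff_left₀ (norm_nonneg _) (norm_nonneg _) two_ne_zero).1 hle

theorem norm_ketProj_le (F : Finset κ) : ‖ketProj E b F‖ ≤ 1 :=
  ContinuousLinearMap.opNorm_le_bound _ zero_le_one fun w => by
    simpa using hE.norm_ketProj_apply_le b F w

theorem norm_corner_le (F : Finset κ) (T : Y →L[ℂ] Y) :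
    ‖ketProj E b F ∘L T ∘L ketProj E b F‖ ≤ ‖T‖ := by
  calc ‖ketProj E b F ∘L T ∘L ketProj E b F‖
      ≤ ‖ketProj E b F‖ * (‖T‖ * ‖ketProj E b F‖) :=
        (ContinuousLinearMap.opNorm_comp_le _ _).trans <| by
          gcongr
          exact ContinuousLinearMap.opNorm_comp_le _ _
    _ ≤ 1 * (‖T‖ * 1) := by gcongr <;> exact hE.norm_ketProj_le b F
    _ = ‖T‖ := by ring

omit hE [CompleteSpace K] in
theorem adjoint_ketProj (F : Finset κ) : (ketProj E b F).adjoint = ketProj E b F := by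
  simp [ketProj, ContinuousLinearMap.adjoint_comp, map_sum]

omit hE [CompleteSpace K] in
/-- The coordinate expansion of an operator cut down to `X ⊗ span {bᵢ | i ∈ F}`. -/
theorem ketProj_comp_comp (F : Finset κ) (T : Y →L[ℂ] Y) :
    ketProj E b F ∘L T ∘L ketProj E b F =
      ∑ i ∈ F, ∑ j ∈ F, E (b i) ∘L ((E (b i)).adjoint ∘L T ∘L E (b j)) ∘L (E (b j)).adjoint := by
  ext w
  simp only [ketProj, ContinuousLinearMap.comp_apply, sum_apply, map_sum]
  exact Finset.sum_comm

end IsKet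

end Kets

/-! ### Tensor products with `K` as ket families -/

section Instances

theorem opTensor_apply_ketE {H₁ H₂ K₁ K₂ : Type*}
    [NormedAddCommGroup H₁] [InnerProductSpace ℂ H₁]
    [NormedAddCommGroup H₂] [InnerProductSpace ℂ H₂]
    [NormedAddCommGroup K₁] [InnerProductSpace ℂ K₁]
    [NormedAddCommGroup K₂] [InnerProductSpace ℂ K₂]
    (a : H₁ →L[ℂ] H₂) (b : K₁ →L[ℂ] K₂) (y : K₁) (w : H₁) :
    opTensor a b (ketE H₁ y w) = ketE H₂ (b y) (a w) := by
  simp [opTensor, ketE, ContinuousLinearMap.completion_apply_coe]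

variable {H K : Type*}
  [NormedAddCommGroup H] [InnerProductSpace ℂ H]
  [NormedAddCommGroup K] [InnerProductSpace ℂ K]

theorem isKet_ketE : IsKet (ketE H : K → H →L[ℂ] HilbTensor H K) where
  inner_eq x y u v := inner_ketE x y u v
  total w hw := by
    rw [← inner_self_eq_zero (𝕜 := ℂ)]
    have : ∀ z : HilbTensor H K, ⟪z, w⟫_ℂ = 0 := by
      intro z
      induction z using UniformSpace.Completion.induction_on with
      | hp => exact isClosed_eq (by fun_prop) continuous_const
      | ih t =>
        induction t using TensorProduct.induction_on with
        | zero => rw [UniformSpace.Completion.coe_zero, inner_zero_left]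
        | tmul u x => exact hw x u
        | add s t hs ht => rw [UniformSpace.Completion.coe_add, inner_add_left, hs, ht, add_zero]
    exact this w

theorem isKet_snocTensor (m : ℕ) :
    IsKet (snocTensor m : K → TensorPow K m →L[ℂ] TensorPow K (m + 1)) where
  inner_eq x y u v := (isKet_ketE (H := TensorPow K m) (K := K)).inner_eq x y u v
  total w hw := (isKet_ketE (H := TensorPow K m) (K := K)).total w hw

theorem isKet_ketEPow (m : ℕ) :
    IsKet (ketEPow H m : K → HilbTensor H (TensorPow K m) →L[ℂ]
      HilbTensor H (TensorPow K (m + 1))) where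
  inner_eq x y ζ ζ' := by
    induction ζ, ζ' using UniformSpace.Completion.induction_on₂ with
    | hp => exact isClosed_eq (by fun_prop) (by fun_prop)
    | ih s t =>
      induction s using TensorProduct.induction_on with
      | zero => simp [UniformSpace.Completion.coe_zero]
      | add s s' hs hs' =>
        simp only [UniformSpace.Completion.coe_add, map_add, inner_add_left, hs, hs', add_mul]
      | tmul u ξ =>
        induction t using TensorProduct.induction_on with
        | zero => simp [UniformSpace.Completion.coe_zero]
        | add s s' hs hs' =>
          simp only [UniformSpace.Completion.coe_add, map_add, inner_add_right, hs, hs', add_mul]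
        | tmul v η =>
          have h1 : ((u ⊗ₜ[ℂ] ξ : H ⊗[ℂ] TensorPow K m) : HilbTensor H (TensorPow K m)) =
            ketE H ξ u := rfl
          have h2 : ((v ⊗ₜ[ℂ] η : H ⊗[ℂ] TensorPow K m) : HilbTensor H (TensorPow K m)) =
            ketE H η v := rfl
          rw [h1, h2, ketEPow, ketEPow, opTensor_apply_ketE, opTensor_apply_ketE, inner_ketE,
            inner_ketE, (isKet_snocTensor m).inner_eq]
          simp [mul_assoc]
  total w hw := by
    refine isKet_ketE.total w fun η u => ?_
    rw [← isKet_ketE.flip_apply, ← ContinuousLinearMap.adjoint_inner_right]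
    have h0 : (isKet_ketE.flip u).adjoint w = 0 := by
      refine (isKet_snocTensor m).total _ fun x ξ => ?_
      rw [ContinuousLinearMap.adjoint_inner_right, isKet_ketE.flip_apply, ← hw x (ketE H ξ u),
        ketEPow, opTensor_apply_ketE]
      rfl
    rw [h0, inner_zero_right]

end Instances

/-! ### Ampliation of `*`-homomorphisms -/

section Ampliation

variable {𝒜 : Type*} [NonUnitalCStarAlgebra 𝒜]
  {K : Type*} [NormedAddCommGroup K] [InnerProductSpace ℂ K] [CompleteSpace K]
  {X₁ Y₁ X₂ Y₂ : Type*}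
  [NormedAddCommGroup X₁] [InnerProductSpace ℂ X₁] [CompleteSpace X₁]
  [NormedAddCommGroup Y₁] [InnerProductSpace ℂ Y₁] [CompleteSpace Y₁]
  [NormedAddCommGroup X₂] [InnerProductSpace ℂ X₂] [CompleteSpace X₂]
  [NormedAddCommGroup Y₂] [InnerProductSpace ℂ Y₂] [CompleteSpace Y₂]

omit [CompleteSpace K] in
open scoped Classical in
theorem IsKet.adjoint_apply_basis {E : K → X₁ →L[ℂ] Y₁} (hE : IsKet E) {κ : Type*}
    (b : HilbertBasis κ ℂ K) (i j : κ) (u : X₁) :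
    (E (b i)).adjoint (E (b j) u) = if i = j then u else 0 := by
  rw [hE.adjoint_apply, orthonormal_iff_ite.1 b.orthonormal]
  split_ifs <;> simp

omit [CompleteSpace K] in
/-- The representation of `M_F(𝒜)` on `X ⊗ span {bᵢ | i ∈ F} ⊆ X ⊗ K` obtained by applying a
representation `π` of `𝒜` on `X` entrywise: the matrix `M` acts as `∑ E_{bᵢ} π(Mᵢⱼ) E^{bⱼ}`. -/
def matrixRep {E : K → X₁ →L[ℂ] Y₁} (hE : IsKet E) {κ : Type*} (b : HilbertBasis κ ℂ K)
    (F : Finset κ) (π : 𝒜 →⋆ₙₐ[ℂ] (X₁ →L[ℂ] X₁)) :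
    CStarMatrix F F 𝒜 →⋆ₙₐ[ℂ] (Y₁ →L[ℂ] Y₁) where
  toFun M := ∑ i : F, ∑ j : F, E (b i) ∘L π (M i j) ∘L (E (b j)).adjoint
  map_smul' c M := by
    simp [Finset.smul_sum]
  map_zero' := by simp
  map_add' M N := by
    simp [Finset.sum_add_distrib, ContinuousLinearMap.add_comp]
  map_mul' M N := by
    classical
    have h := fun j k : F => hE.adjoint_apply_basis b j k
    ext w
    simp only [CStarMatrix.mul_apply, map_sum, map_mul, sum_apply, ContinuousLinearMap.comp_apply,
      mul_apply_eq_comp, h, Subtype.coe_inj]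
    simp only [apply_ite, map_zero, Finset.sum_ite_eq', Finset.mem_univ, if_true]
    symm
    refine (Finset.sum_congr rfl fun p _ => Finset.sum_comm).trans ?_
    rw [Finset.sum_comm]
    exact Finset.sum_congr rfl fun r _ => Finset.sum_comm
  map_star' M := by
    rw [ContinuousLinearMap.star_eq_adjoint, map_sum, Finset.sum_comm]
    refine Finset.sum_congr rfl fun i _ => ?_
    rw [map_sum]
    refine Finset.sum_congr rfl fun j _ => ?_
    rw [CStarMatrix.star_apply, map_star, ContinuousLinearMap.star_eq_adjoint,
      ContinuousLinearMap.adjoint_comp, ContinuousLinearMap.adjoint_comp,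
      ContinuousLinearMap.adjoint_adjoint, ContinuousLinearMap.comp_assoc]

omit [CompleteSpace K] in
theorem matrixRep_apply {E : K → X₁ →L[ℂ] Y₁} (hE : IsKet E) {κ : Type*} (b : HilbertBasis κ ℂ K)
    (F : Finset κ) (π : 𝒜 →⋆ₙₐ[ℂ] (X₁ →L[ℂ] X₁)) (M : CStarMatrix F F 𝒜) :
    matrixRep hE b F π M = ∑ i : F, ∑ j : F, E (b i) ∘L π (M i j) ∘L (E (b j)).adjoint := rfl

omit [CompleteSpace K] in
theorem ketProj_comp_comp_eq_matrixRep {E : K → X₁ →L[ℂ] Y₁} (hE : IsKet E) {κ : Type*}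
    (b : HilbertBasis κ ℂ K) (F : Finset κ) (π : 𝒜 →⋆ₙₐ[ℂ] (X₁ →L[ℂ] X₁)) {T : Y₁ →L[ℂ] Y₁}
    {M : CStarMatrix F F 𝒜} (h : ∀ i j, π (M i j) = (E (b i)).adjoint ∘L T ∘L E (b j)) :
    ketProj E b F ∘L T ∘L ketProj E b F = matrixRep hE b F π M := by
  rw [IsKet.ketProj_comp_comp, matrixRep_apply]
  simp only [h]
  refine (Finset.sum_coe_sort F _).symm.trans (Finset.sum_congr rfl fun i _ => ?_)
  exact (Finset.sum_coe_sort F _).symm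

omit [CompleteSpace K] in
/-- The entrywise action of `π` is dominated in norm by that of a faithful `ι`: the representation
of the C*-algebra `M_F(𝒜)` induced by `ι` is faithful, hence isometric, and that induced by `π` is
contractive. -/
theorem norm_matrixRep_le {E₁ : K → X₁ →L[ℂ] Y₁} (hE₁ : IsKet E₁)
    {E₂ : K → X₂ →L[ℂ] Y₂} (hE₂ : IsKet E₂) {κ : Type*} (b : HilbertBasis κ ℂ K) (F : Finset κ)
    {ι : 𝒜 →⋆ₙₐ[ℂ] (X₁ →L[ℂ] X₁)} (hι : Function.Injective ι)
    (π : 𝒜 →⋆ₙₐ[ℂ] (X₂ →L[ℂ] X₂)) (M : CStarMatrix F F 𝒜) :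
    ‖matrixRep hE₂ b F π M‖ ≤ ‖matrixRep hE₁ b F ι M‖ := by
  let _ := CStarAlgebra.spectralOrder 𝒜
  let _ := CStarAlgebra.spectralOrderedRing 𝒜
  have hinj : Function.Injective (matrixRep hE₁ b F ι) := by
    rw [injective_iff_map_eq_zero]
    intro M hM
    ext i j
    refine hι ?_
    classical
    have h := fun j k : F => hE₁.adjoint_apply_basis b j k
    ext u
    have := congrArg (fun S : Y₁ →L[ℂ] Y₁ => (E₁ (b i)).adjoint (S (E₁ (b j) u))) hM
    simpa [matrixRep, map_sum, h, apply_ite] using this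
  rw [NonUnitalStarAlgHom.norm_map _ hinj]
  exact NonUnitalStarAlgHom.norm_apply_le _ M

/-- `S` is the ampliation `(π ⊗ id)(T)` of the operator `T` on `X₁ ⊗ K` along the map `ι a ↦ π a`
between the ranges of two representations of `𝒜`: all slices of `T` are of the form `ι a`, and the
corresponding slices of `S` are `π a`. -/
def IsAmpliation (E₁ : K → X₁ →L[ℂ] Y₁) (E₂ : K → X₂ →L[ℂ] Y₂) (ι : 𝒜 →⋆ₙₐ[ℂ] (X₁ →L[ℂ] X₁))
    (π : 𝒜 →⋆ₙₐ[ℂ] (X₂ →L[ℂ] X₂)) (T : Y₁ →L[ℂ] Y₁) (S : Y₂ →L[ℂ] Y₂) : Prop :=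
  ∀ x y, ∃ a, ι a = (E₁ x).adjoint ∘L T ∘L E₁ y ∧ π a = (E₂ x).adjoint ∘L S ∘L E₂ y

/-- Every norm-bounded family of operators has a weak limit along every ultrafilter. -/
theorem exists_tendsto_inner_of_bounded {α : Type*} (𝒰 : Ultrafilter α) (S : α → Y₁ →L[ℂ] Y₁)
    (C : ℝ) (hS : ∀ i, ‖S i‖ ≤ C) :
    ∃ S₀ : Y₁ →L[ℂ] Y₁, ∀ x y, Tendsto (fun i => ⟪x, S i y⟫_ℂ) 𝒰 (𝓝 ⟪x, S₀ y⟫_ℂ) := by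
  have hb : ∀ x y i, ‖⟪S i y, x⟫_ℂ‖ ≤ C * ‖y‖ * ‖x‖ := fun x y i =>
    (norm_inner_le_norm _ _).trans (mul_le_mul_of_nonneg_right
      ((S i).le_of_opNorm_le (hS i) y) (norm_nonneg _))
  have hex : ∀ x y, ∃ z ∈ Metric.closedBall (0 : ℂ) (C * ‖y‖ * ‖x‖),
      Tendsto (fun i => ⟪S i y, x⟫_ℂ) 𝒰 (𝓝 z) := by
    intro x y
    obtain ⟨z, hz, h⟩ := (isCompact_closedBall (0 : ℂ) (C * ‖y‖ * ‖x‖)).ultrafilter_le_nhds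
      (𝒰.map fun i => ⟪S i y, x⟫_ℂ) (by
        rw [le_principal_iff]
        exact mem_map.2 (Eventually.of_forall fun i => by simpa using hb x y i))
    exact ⟨z, hz, h⟩
  choose B hB hlim using hex
  let f : Y₁ →ₗ⋆[ℂ] Y₁ →ₗ[ℂ] ℂ := LinearMap.mk₂'ₛₗ (starRingEnd ℂ) (RingHom.id ℂ)
    (fun y x => B x y)
    (fun y y' x => tendsto_nhds_unique (hlim x (y + y')) (by
      simpa [inner_add_left] using (hlim x y).add (hlim x y')))
    (fun c y x => tendsto_nhds_unique (hlim x (c • y)) (by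
      simpa [inner_smul_left, mul_comm] using (hlim x y).const_mul (starRingEnd ℂ c)))
    (fun y x x' => tendsto_nhds_unique (hlim (x + x') y) (by
      simpa [inner_add_right] using (hlim x y).add (hlim x' y)))
    (fun c y x => tendsto_nhds_unique (hlim (c • x) y) (by
      simpa [inner_smul_right] using (hlim x y).const_mul c))
  have hf : ∀ y x, ‖f y x‖ ≤ C * ‖y‖ * ‖x‖ := fun y x => by simpa using! hB x y
  refine ⟨InnerProductSpace.continuousLinearMapOfBilin (f.mkContinuous₂ C hf), fun x y => ?_⟩
  have h := (Complex.continuous_conj.tendsto _).comp (hlim x y)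
  have hBf : B x y =
      ⟪InnerProductSpace.continuousLinearMapOfBilin (f.mkContinuous₂ C hf) y, x⟫_ℂ := by
    rw [InnerProductSpace.continuousLinearMapOfBilin_apply]
    rfl
  rw [hBf, inner_conj_symm] at h
  refine h.congr fun i => ?_
  exact inner_conj_symm _ _

variable {E₁ : K → X₁ →L[ℂ] Y₁} {E₂ : K → X₂ →L[ℂ] Y₂}
  {ι : 𝒜 →⋆ₙₐ[ℂ] (X₁ →L[ℂ] X₁)} {π : 𝒜 →⋆ₙₐ[ℂ] (X₂ →L[ℂ] X₂)}

namespace IsAmpliation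

omit [NormedAddCommGroup K] [InnerProductSpace ℂ K] [CompleteSpace K] in
theorem add {T T' : Y₁ →L[ℂ] Y₁} {S S' : Y₂ →L[ℂ] Y₂} (h : IsAmpliation E₁ E₂ ι π T S)
    (h' : IsAmpliation E₁ E₂ ι π T' S') : IsAmpliation E₁ E₂ ι π (T + T') (S + S') := by
  intro x y
  obtain ⟨a, ha, ha'⟩ := h x y
  obtain ⟨c, hc, hc'⟩ := h' x y
  exact ⟨a + c, by simp [ha, hc, ContinuousLinearMap.add_comp],
    by simp [ha', hc', ContinuousLinearMap.add_comp]⟩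

omit [NormedAddCommGroup K] [InnerProductSpace ℂ K] [CompleteSpace K] in
theorem smul (c : ℂ) {T : Y₁ →L[ℂ] Y₁} {S : Y₂ →L[ℂ] Y₂} (h : IsAmpliation E₁ E₂ ι π T S) :
    IsAmpliation E₁ E₂ ι π (c • T) (c • S) := by
  intro x y
  obtain ⟨a, ha, ha'⟩ := h x y
  exact ⟨c • a, by simp [ha], by simp [ha']⟩

omit [NormedAddCommGroup K] [InnerProductSpace ℂ K] [CompleteSpace K] in
theorem sub {T T' : Y₁ →L[ℂ] Y₁} {S S' : Y₂ →L[ℂ] Y₂} (h : IsAmpliation E₁ E₂ ι π T S)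
    (h' : IsAmpliation E₁ E₂ ι π T' S') : IsAmpliation E₁ E₂ ι π (T - T') (S - S') := by
  simpa [sub_eq_add_neg] using h.add (h'.smul (-1))

omit [NormedAddCommGroup K] [InnerProductSpace ℂ K] [CompleteSpace K] in
theorem zero : IsAmpliation E₁ E₂ ι π 0 0 := fun x y => ⟨0, by simp, by simp⟩

omit [NormedAddCommGroup K] [InnerProductSpace ℂ K] [CompleteSpace K] in
theorem star {T : Y₁ →L[ℂ] Y₁} {S : Y₂ →L[ℂ] Y₂} (h : IsAmpliation E₁ E₂ ι π T S) :
    IsAmpliation E₁ E₂ ι π (star T) (star S) := by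
  intro x y
  obtain ⟨a, ha, ha'⟩ := h y x
  exact ⟨Star.star a,
    by simp [map_star, ha, ContinuousLinearMap.star_eq_adjoint, ContinuousLinearMap.adjoint_comp,
      ContinuousLinearMap.comp_assoc],
    by simp [map_star, ha', ContinuousLinearMap.star_eq_adjoint, ContinuousLinearMap.adjoint_comp,
      ContinuousLinearMap.comp_assoc]⟩

/-- Ampliation is contractive: finite corners are entrywise images of matrices, and these are
dominated in norm because `ι` induces an isometric representation of the matrix algebra. -/
theorem norm_le (hE₁ : IsKet E₁) (hE₂ : IsKet E₂) (hι : Function.Injective ι) {T : Y₁ →L[ℂ] Y₁}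
    {S : Y₂ →L[ℂ] Y₂} (h : IsAmpliation E₁ E₂ ι π T S) : ‖S‖ ≤ ‖T‖ := by
  obtain ⟨w, b, -⟩ := exists_hilbertBasis ℂ K
  choose a ha ha' using h
  have hcorner : ∀ F : Finset w, ‖ketProj E₂ b F ∘L S ∘L ketProj E₂ b F‖ ≤ ‖T‖ := by
    intro F
    let M : CStarMatrix F F 𝒜 := CStarMatrix.ofMatrix fun i j => a (b i) (b j)
    have h1 : ketProj E₁ b F ∘L T ∘L ketProj E₁ b F = matrixRep hE₁ b F ι M :=
      ketProj_comp_comp_eq_matrixRep hE₁ b F ι fun i j => ha _ _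
    have h2 : ketProj E₂ b F ∘L S ∘L ketProj E₂ b F = matrixRep hE₂ b F π M :=
      ketProj_comp_comp_eq_matrixRep hE₂ b F π fun i j => ha' _ _
    rw [h2]
    refine (norm_matrixRep_le hE₁ hE₂ b F hι π M).trans ?_
    rw [← h1]
    exact hE₁.norm_corner_le b F T
  refine ContinuousLinearMap.opNorm_le_bound _ (norm_nonneg _) fun v => ?_
  have hlim : Tendsto (fun F => ketProj E₂ b F (S (ketProj E₂ b F v))) atTop (𝓝 (S v)) := by
    have h0 : Tendsto (fun F => ketProj E₂ b F (S (ketProj E₂ b F v) - S v)) atTop (𝓝 0) := by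
      refine squeeze_zero_norm (fun F => hE₂.norm_ketProj_apply_le b F _) ?_
      rw [← tendsto_zero_iff_norm_tendsto_zero, ← sub_self (S v)]
      exact ((S.continuous.tendsto _).comp (hE₂.tendsto_ketProj b v)).sub_const _
    simpa [map_sub] using h0.add (hE₂.tendsto_ketProj b (S v))
  refine le_of_tendsto' hlim.norm fun F => ?_
  exact ContinuousLinearMap.le_of_opNorm_le _ (hcorner F) v

omit [CompleteSpace K] in
theorem unique (hE₂ : IsKet E₂) (hι : Function.Injective ι) {T : Y₁ →L[ℂ] Y₁}
    {S S' : Y₂ →L[ℂ] Y₂} (h : IsAmpliation E₁ E₂ ι π T S) (h' : IsAmpliation E₁ E₂ ι π T S') :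
    S = S' := by
  refine hE₂.ext_op fun x y => ?_
  obtain ⟨a, ha, ha'⟩ := h x y
  obtain ⟨c, hc, hc'⟩ := h' x y
  rw [← ha', ← hc', hι (ha.trans hc.symm)]

end IsAmpliation

end Ampliation

section Ampliation

variable {𝒜 : Type*} [NonUnitalCStarAlgebra 𝒜]
  {K : Type*} [NormedAddCommGroup K] [InnerProductSpace ℂ K] [CompleteSpace K]
  {X₁ Y₁ X₂ Y₂ : Type*}
  [NormedAddCommGroup X₁] [InnerProductSpace ℂ X₁] [CompleteSpace X₁]
  [NormedAddCommGroup Y₁] [InnerProductSpace ℂ Y₁] [CompleteSpace Y₁]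
  [NormedAddCommGroup X₂] [InnerProductSpace ℂ X₂] [CompleteSpace X₂]
  [NormedAddCommGroup Y₂] [InnerProductSpace ℂ Y₂] [CompleteSpace Y₂]
  {E₁ : K → X₁ →L[ℂ] Y₁} {E₂ : K → X₂ →L[ℂ] Y₂}
  {ι : 𝒜 →⋆ₙₐ[ℂ] (X₁ →L[ℂ] X₁)} {π : 𝒜 →⋆ₙₐ[ℂ] (X₂ →L[ℂ] X₂)}

theorem continuous_nonUnitalStarAlgHom {B C : Type*} [NonUnitalCStarAlgebra B]
    [NonUnitalCStarAlgebra C] (f : B →⋆ₙₐ[ℂ] C) : Continuous f :=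
  AddMonoidHomClass.continuous_of_bound f 1 fun c => by
    rw [one_mul]
    exact NonUnitalStarAlgHom.norm_apply_le f c

omit [CompleteSpace K] in
theorem IsKet.continuous_slice (hE₁ : IsKet E₁) (T : Y₁ →L[ℂ] Y₁) :
    Continuous fun q : K × K => (E₁ q.1).adjoint ∘L T ∘L E₁ q.2 := by
  have h1 : Continuous fun q : K × K => E₁ q.1 := hE₁.continuous.comp continuous_fst
  have h2 : Continuous fun q : K × K => E₁ q.2 := hE₁.continuous.comp continuous_snd
  have h3 : Continuous fun q : K × K => (E₁ q.1).adjoint :=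
    ContinuousLinearMap.adjoint.continuous.comp h1
  exact h3.clm_comp (continuous_const.clm_comp h2)

namespace IsAmpliation

omit [CompleteSpace K] in
theorem slice_matrixRep {E : K → X₁ →L[ℂ] Y₁} (hE : IsKet E) {κ : Type*} (b : HilbertBasis κ ℂ K)
    (F : Finset κ) (π : 𝒜 →⋆ₙₐ[ℂ] (X₁ →L[ℂ] X₁)) (M : CStarMatrix F F 𝒜) (x y : K) :
    (E x).adjoint ∘L matrixRep hE b F π M ∘L E y =
      π (∑ i : F, ∑ j : F, (⟪x, b i⟫_ℂ * ⟪b j, y⟫_ℂ) • M i j) := by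
  ext u
  simp only [matrixRep_apply, map_sum, sum_apply, ContinuousLinearMap.comp_apply, map_smul,
    smul_apply, hE.adjoint_apply, smul_smul]
  exact Finset.sum_congr rfl fun i _ => Finset.sum_congr rfl fun j _ => by rw [mul_comm]

/-- Every operator whose slices lie in `ι(𝒜)` has an ampliation: its finite corners are uniformly
bounded, and any weak limit point of them will do. -/
theorem exists_of_slices (hE₁ : IsKet E₁) (hE₂ : IsKet E₂) (hι : Function.Injective ι)
    {T : Y₁ →L[ℂ] Y₁} (hT : ∀ x y, ∃ a, ι a = (E₁ x).adjoint ∘L T ∘L E₁ y) :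
    ∃ S, IsAmpliation E₁ E₂ ι π T S := by
  obtain ⟨w, b, -⟩ := exists_hilbertBasis ℂ K
  choose a ha using hT
  let M : (F : Finset w) → CStarMatrix F F 𝒜 := fun F =>
    CStarMatrix.ofMatrix fun i j => a (b i) (b j)
  have hM₁ : ∀ F, matrixRep hE₁ b F ι (M F) = ketProj E₁ b F ∘L T ∘L ketProj E₁ b F := by
    exact fun F => (ketProj_comp_comp_eq_matrixRep hE₁ b F ι fun i j => ha _ _).symm
  have hbound : ∀ F, ‖matrixRep hE₂ b F π (M F)‖ ≤ ‖T‖ := by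
    intro F
    refine (norm_matrixRep_le hE₁ hE₂ b F hι π (M F)).trans ?_
    rw [hM₁]
    exact hE₁.norm_corner_le b F T
  obtain ⟨S, hS⟩ := exists_tendsto_inner_of_bounded (Ultrafilter.of (atTop : Filter (Finset w)))
    (fun F => matrixRep hE₂ b F π (M F)) ‖T‖ hbound
  refine ⟨S, fun x y => ⟨a x y, ha x y, ?_⟩⟩
  -- the slice of the corner at `F` is the slice of `T` at the projections `p F x`, `p F y`
  let p : Finset w → K → K := fun F x => ∑ i ∈ F, ⟪b i, x⟫_ℂ • b i
  have hp : ∀ x, Tendsto (fun F => p F x) atTop (𝓝 x) := fun x => by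
    have h : Tendsto _ _ _ := b.hasSum_repr x
    simpa [p, SummationFilter.unconditional, b.repr_apply_apply] using h
  have hslice : ∀ F : Finset w, ∑ i : F, ∑ j : F, (⟪x, b i⟫_ℂ * ⟪b j, y⟫_ℂ) • M F i j =
      a (p F x) (p F y) := by
    intro F
    refine hι ?_
    rw [← slice_matrixRep hE₁ b F ι (M F) x y, hM₁, ha]
    have hproj : ∀ z, ketProj E₁ b F ∘L E₁ z = E₁ (p F z) := by
      intro z
      ext u
      simp [ketProj, hE₁.adjoint_apply, p, hE₁.map_finsetSum, hE₁.map_smul]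
    have hproj' : (E₁ x).adjoint ∘L ketProj E₁ b F = (E₁ (p F x)).adjoint := by
      rw [← hproj, ContinuousLinearMap.adjoint_comp, IsKet.adjoint_ketProj]
    rw [← hproj', ← hproj]
    simp only [ContinuousLinearMap.comp_assoc]
  have hlim : Tendsto (fun F => a (p F x) (p F y)) atTop (𝓝 (a x y)) := by
    have h := ((hE₁.continuous_slice T).tendsto (x, y)).comp ((hp x).prodMk_nhds (hp y))
    rw [tendsto_iff_dist_tendsto_zero] at h ⊢
    refine h.congr fun F => ?_
    rw [← (NonUnitalStarAlgHom.isometry ι hι).dist_eq, ha, ha]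
    rfl
  have hcont := continuous_nonUnitalStarAlgHom π
  have hlim' := ((hcont.tendsto _).comp hlim).mono_left (Ultrafilter.of_le atTop)
  ext u
  refine ext_inner_left ℂ fun v => ?_
  have h1 := hS (E₂ x v) (E₂ y u)
  have h2 : ∀ F, ⟪E₂ x v, matrixRep hE₂ b F π (M F) (E₂ y u)⟫_ℂ =
      ⟪v, π (a (p F x) (p F y)) u⟫_ℂ := by
    intro F
    rw [← hslice F, ← slice_matrixRep hE₂ b F π (M F) x y]
    simp [ContinuousLinearMap.adjoint_inner_right]
  simp only [h2] at h1
  have hc : Continuous fun R : X₂ →L[ℂ] X₂ => ⟪v, R u⟫_ℂ := by fun_prop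
  rw [tendsto_nhds_unique ((hc.tendsto _).comp hlim') h1]
  simp [ContinuousLinearMap.adjoint_inner_right]

omit [NormedAddCommGroup K] [InnerProductSpace ℂ K] [CompleteSpace K] in
/-- The graph of ampliation is norm closed, because the graph `{(ι a, π a)}` is. -/
theorem isClosed_graph (hι : Function.Injective ι) :
    IsClosed {p : (Y₁ →L[ℂ] Y₁) × (Y₂ →L[ℂ] Y₂) | IsAmpliation E₁ E₂ ι π p.1 p.2} := by
  have hiso : Isometry fun a => (ι a, π a) := by
    refine Isometry.of_dist_eq fun a c => ?_
    rw [Prod.dist_eq, (NonUnitalStarAlgHom.isometry ι hι).dist_eq]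
    refine max_eq_left ?_
    rw [dist_eq_norm, dist_eq_norm, ← _root_.map_sub]
    exact NonUnitalStarAlgHom.norm_apply_le π _
  have hclosed := hiso.isClosedEmbedding.isClosed_range
  have heq : {p : (Y₁ →L[ℂ] Y₁) × (Y₂ →L[ℂ] Y₂) | IsAmpliation E₁ E₂ ι π p.1 p.2} =
      ⋂ x, ⋂ y, (fun p : (Y₁ →L[ℂ] Y₁) × (Y₂ →L[ℂ] Y₂) =>
        ((E₁ x).adjoint ∘L p.1 ∘L E₁ y, (E₂ x).adjoint ∘L p.2 ∘L E₂ y)) ⁻¹'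
          Set.range fun a => (ι a, π a) := by
    ext p
    simp [IsAmpliation]
  rw [heq]
  refine isClosed_iInter fun x => isClosed_iInter fun y => hclosed.preimage ?_
  fun_prop

/-- Since ampliation is contractive, approximating `T` by operators with known ampliations
approximates the ampliation of `T` as well; so closed conditions on the pair pass to the limit. -/
theorem closure_induction (hE₁ : IsKet E₁) (hE₂ : IsKet E₂) (hι : Function.Injective ι)
    {P : (Y₁ →L[ℂ] Y₁) → (Y₂ →L[ℂ] Y₂) → Prop}
    (hP : IsClosed {p : (Y₁ →L[ℂ] Y₁) × (Y₂ →L[ℂ] Y₂) | P p.1 p.2})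
    {D : Set (Y₁ →L[ℂ] Y₁)} (hD : ∀ T ∈ D, ∃ S, IsAmpliation E₁ E₂ ι π T S ∧ P T S)
    {T : Y₁ →L[ℂ] Y₁} {S : Y₂ →L[ℂ] Y₂} (h : IsAmpliation E₁ E₂ ι π T S) (hT : T ∈ closure D) :
    P T S := by
  have hmem : (T, S) ∈ closure {p : (Y₁ →L[ℂ] Y₁) × (Y₂ →L[ℂ] Y₂) | P p.1 p.2} := by
    rw [Metric.mem_closure_iff] at hT ⊢
    intro ε hε
    obtain ⟨T₀, hT₀, hd⟩ := hT ε hε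
    obtain ⟨S₀, hS₀, hP₀⟩ := hD T₀ hT₀
    refine ⟨(T₀, S₀), hP₀, ?_⟩
    rw [Prod.dist_eq]
    refine max_lt hd (lt_of_le_of_lt ?_ hd)
    rw [dist_eq_norm, dist_eq_norm]
    exact (h.sub hS₀).norm_le hE₁ hE₂ hι
  exact hP.closure_subset hmem

theorem mem_of_mem_closure (hE₁ : IsKet E₁) (hE₂ : IsKet E₂) (hι : Function.Injective ι)
    {Z : Set (Y₂ →L[ℂ] Y₂)} (hZ : IsClosed Z)
    {D : Set (Y₁ →L[ℂ] Y₁)} (hD : ∀ T ∈ D, ∃ S ∈ Z, IsAmpliation E₁ E₂ ι π T S)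
    {T : Y₁ →L[ℂ] Y₁} {S : Y₂ →L[ℂ] Y₂} (h : IsAmpliation E₁ E₂ ι π T S) (hT : T ∈ closure D) :
    S ∈ Z :=
  closure_induction (P := fun _ S => S ∈ Z) hE₁ hE₂ hι (hZ.preimage continuous_snd)
    (fun T₀ hT₀ => by
      obtain ⟨S₀, hS₀, h₀⟩ := hD T₀ hT₀
      exact ⟨S₀, h₀, hS₀⟩) h hT

/-- Multiplicativity in the left factor passes to norm limits. -/
theorem mul_of_mem_closure (hE₁ : IsKet E₁) (hE₂ : IsKet E₂) (hι : Function.Injective ι)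
    {T' : Y₁ →L[ℂ] Y₁} {S' : Y₂ →L[ℂ] Y₂} {D : Set (Y₁ →L[ℂ] Y₁)}
    (hD : ∀ T ∈ D, ∃ S, IsAmpliation E₁ E₂ ι π T S ∧ IsAmpliation E₁ E₂ ι π (T * T') (S * S'))
    {T : Y₁ →L[ℂ] Y₁} {S : Y₂ →L[ℂ] Y₂} (h : IsAmpliation E₁ E₂ ι π T S) (hT : T ∈ closure D) :
    IsAmpliation E₁ E₂ ι π (T * T') (S * S') := by
  have hc : Continuous fun p : (Y₁ →L[ℂ] Y₁) × (Y₂ →L[ℂ] Y₂) => (p.1 * T', p.2 * S') :=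
    (continuous_fst.mul continuous_const).prodMk (continuous_snd.mul continuous_const)
  exact closure_induction (P := fun T S => IsAmpliation E₁ E₂ ι π (T * T') (S * S')) hE₁ hE₂ hι
    ((isClosed_graph hι).preimage hc) hD h hT

end IsAmpliation
end Ampliation

/-! ### Elementary tensors -/

section OpTensor

variable {H K : Type*}
  [NormedAddCommGroup H] [InnerProductSpace ℂ H] [CompleteSpace H]
  [NormedAddCommGroup K] [InnerProductSpace ℂ K] [CompleteSpace K]

/-- The amplification `a ↦ a ⊗ 1` as a representation of `B(H)` on `H ⊗ K`. -/
def amplify (H K : Type*) [NormedAddCommGroup H] [InnerProductSpace ℂ H] [CompleteSpace H]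
    [NormedAddCommGroup K] [InnerProductSpace ℂ K] [CompleteSpace K] :
    (H →L[ℂ] H) →⋆ₙₐ[ℂ] (HilbTensor H K →L[ℂ] HilbTensor H K) where
  toFun a := opTensor a 1
  map_smul' c a := isKet_ketE.ext_comp fun x => by ext u; simp [opTensor_ketE]
  map_zero' := isKet_ketE.ext_comp fun x => by ext u; simp [opTensor_ketE]
  map_add' a b := isKet_ketE.ext_comp fun x => by ext u; simp [opTensor_ketE]
  map_mul' a b := isKet_ketE.ext_comp fun x => by ext u; simp [opTensor_ketE]
  map_star' a := by
    refine isKet_ketE.ext_op fun x y => ?_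
    ext u
    refine ext_inner_left ℂ fun v => ?_
    simp [ContinuousLinearMap.star_eq_adjoint, ContinuousLinearMap.adjoint_inner_right,
      opTensor_ketE, inner_ketE]

@[simp] theorem amplify_apply (a : H →L[ℂ] H) : amplify H K a = opTensor a 1 := rfl

theorem opTensor_eq_amplify_comp (a : H →L[ℂ] H) (b : K →L[ℂ] K) :
    opTensor a b = amplify H K a ∘L opTensor 1 b :=
  isKet_ketE.ext_comp fun x => by ext u; simp [opTensor_ketE]

theorem continuous_opTensor_left (b : K →L[ℂ] K) :
    Continuous fun a : H →L[ℂ] H => opTensor a b := by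
  have hcont := continuous_nonUnitalStarAlgHom (B := H →L[ℂ] H)
    (C := HilbTensor H K →L[ℂ] HilbTensor H K) (amplify H K)
  have h : (fun a : H →L[ℂ] H => opTensor a b) = fun a => amplify H K a ∘L opTensor 1 b :=
    funext fun a => opTensor_eq_amplify_comp a b
  rw [h]
  fun_prop

end OpTensor

section AmpliationTensor

variable {𝒜 : Type*} [NonUnitalCStarAlgebra 𝒜]
  {K : Type*} [NormedAddCommGroup K] [InnerProductSpace ℂ K] [CompleteSpace K]
  {H X Y : Type*}
  [NormedAddCommGroup H] [InnerProductSpace ℂ H] [CompleteSpace H]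
  [NormedAddCommGroup X] [InnerProductSpace ℂ X] [CompleteSpace X]
  [NormedAddCommGroup Y] [InnerProductSpace ℂ Y] [CompleteSpace Y]
  {E : K → X →L[ℂ] Y}
  {ι : 𝒜 →⋆ₙₐ[ℂ] (H →L[ℂ] H)} {π : 𝒜 →⋆ₙₐ[ℂ] (X →L[ℂ] X)}

/-- If the slices of `S` are those of `c ⊗ b`, then `E^x S = c E^{b* x}`. -/
theorem IsKet.adjoint_comp_of_slice (hE : IsKet E) {S : Y →L[ℂ] Y} {c : X →L[ℂ] X} {b : K →L[ℂ] K}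
    (h : ∀ x y, (E x).adjoint ∘L S ∘L E y = ⟪x, b y⟫_ℂ • c) (x : K) :
    (E x).adjoint ∘L S = c ∘L (E (b.adjoint x)).adjoint := by
  refine hE.ext_comp fun y => ?_
  rw [ContinuousLinearMap.comp_assoc, h]
  ext u
  simp [hE.adjoint_apply, ContinuousLinearMap.adjoint_inner_left]

omit [CompleteSpace K] in
theorem slice_opTensor_map (a : 𝒜) (b : K →L[ℂ] K) (x y : K) :
    (ketE H x).adjoint ∘L opTensor (ι a) b ∘L ketE H y = ι (⟪x, b y⟫_ℂ • a) := by
  rw [adjoint_opTensor_ketE, map_smul]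

namespace IsAmpliation

omit [CompleteSpace K] in
/-- The ampliation of `ι a ⊗ b` has the slices of `π a ⊗ b`. -/
theorem slice_of_opTensor (hι : Function.Injective ι) {a : 𝒜} {b : K →L[ℂ] K} {S : Y →L[ℂ] Y}
    (h : IsAmpliation (ketE H) E ι π (opTensor (ι a) b) S) (x y : K) :
    (E x).adjoint ∘L S ∘L E y = ⟪x, b y⟫_ℂ • π a := by
  obtain ⟨c, hc, hc'⟩ := h x y
  rw [slice_opTensor_map] at hc
  rw [← hc', hι hc, map_smul]

omit [CompleteSpace K] in
theorem opTensor_of_slice {a : 𝒜} {b : K →L[ℂ] K} {S : Y →L[ℂ] Y}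
    (h : ∀ x y, (E x).adjoint ∘L S ∘L E y = ⟪x, b y⟫_ℂ • π a) :
    IsAmpliation (ketE H) E ι π (opTensor (ι a) b) S := fun x y =>
  ⟨⟪x, b y⟫_ℂ • a, (slice_opTensor_map a b x y).symm, by rw [h, map_smul]⟩

omit [CompleteSpace K] in
theorem sum {κ : Type*} (F : Finset κ) {T : κ → HilbTensor H K →L[ℂ] HilbTensor H K}
    {S : κ → Y →L[ℂ] Y} (h : ∀ i ∈ F, IsAmpliation (ketE H) E ι π (T i) (S i)) :
    IsAmpliation (ketE H) E ι π (∑ i ∈ F, T i) (∑ i ∈ F, S i) := by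
  classical
  induction F using Finset.induction_on with
  | empty => simpa using IsAmpliation.zero
  | insert i F hi ih =>
    rw [Finset.sum_insert hi, Finset.sum_insert hi]
    exact (h i (Finset.mem_insert_self i F)).add
      (ih fun j hj => h j (Finset.mem_insert_of_mem hj))

theorem exists_of_opTensor (hE : IsKet E) (hι : Function.Injective ι) (a : 𝒜) (b : K →L[ℂ] K) :
    ∃ S, IsAmpliation (ketE H) E ι π (opTensor (ι a) b) S :=
  exists_of_slices isKet_ketE hE hι fun x y => ⟨_, (slice_opTensor_map a b x y).symm⟩

/-- Ampliation respects left multiplication by `ι a ⊗ b`, since `E^x (ι a ⊗ b) = ι a E^{b* x}`. -/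
theorem opTensor_mul (hE : IsKet E) (hι : Function.Injective ι) {a : 𝒜} {b : K →L[ℂ] K}
    {T : HilbTensor H K →L[ℂ] HilbTensor H K} {S S' : Y →L[ℂ] Y}
    (h : IsAmpliation (ketE H) E ι π (opTensor (ι a) b) S)
    (h' : IsAmpliation (ketE H) E ι π T S') :
    IsAmpliation (ketE H) E ι π (opTensor (ι a) b * T) (S * S') := by
  intro x y
  obtain ⟨c, hc, hc'⟩ := h' (b.adjoint x) y
  refine ⟨a * c, ?_, ?_⟩
  · have h1 := isKet_ketE.adjoint_comp_of_slice (adjoint_opTensor_ketE (ι a) b) x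
    rw [map_mul, hc]
    ext u
    have := congrArg (fun f => f (T (ketE H y u))) h1
    simpa using this.symm
  · have h1 := hE.adjoint_comp_of_slice (h.slice_of_opTensor hι) x
    rw [map_mul, hc']
    ext u
    have := congrArg (fun f => f (S' (E y u))) h1
    simpa using this.symm

/-- Every element of the algebraic tensor product has an ampliation, and ampliation respects left
multiplication by it. -/
theorem exists_of_mem_algTensor (hE : IsKet E) (hι : Function.Injective ι)
    {T : HilbTensor H K →L[ℂ] HilbTensor H K} (hT : T ∈ algTensor (Set.range ι) Set.univ) :
    ∃ S, IsAmpliation (ketE H) E ι π T S ∧ ∀ T' S', IsAmpliation (ketE H) E ι π T' S' →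
      IsAmpliation (ketE H) E ι π (T * T') (S * S') := by
  induction hT using Submodule.span_induction with
  | mem T hT =>
    obtain ⟨_, ⟨a, rfl⟩, b, -, rfl⟩ := hT
    obtain ⟨S, hS⟩ := exists_of_opTensor (π := π) hE hι a b
    exact ⟨S, hS, fun T' S' h' => hS.opTensor_mul hE hι h'⟩
  | zero => exact ⟨0, zero, fun T' S' _ => by simpa using! zero⟩
  | add T₁ T₂ _ _ h₁ h₂ =>
    obtain ⟨S₁, hS₁, hm₁⟩ := h₁
    obtain ⟨S₂, hS₂, hm₂⟩ := h₂
    refine ⟨S₁ + S₂, hS₁.add hS₂, fun T' S' h' => ?_⟩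
    rw [add_mul, add_mul]
    exact (hm₁ T' S' h').add (hm₂ T' S' h')
  | smul c T _ h =>
    obtain ⟨S, hS, hm⟩ := h
    refine ⟨c • S, hS.smul c, fun T' S' h' => ?_⟩
    rw [smul_mul_assoc, smul_mul_assoc]
    exact (hm T' S' h').smul c

/-- Ampliation is multiplicative on the spatial tensor product. -/
theorem mul_of_mem_spatialTensor (hE : IsKet E) (hι : Function.Injective ι)
    {T T' : HilbTensor H K →L[ℂ] HilbTensor H K} {S S' : Y →L[ℂ] Y}
    (hT : T ∈ spatialTensor (Set.range ι) Set.univ)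
    (h : IsAmpliation (ketE H) E ι π T S) (h' : IsAmpliation (ketE H) E ι π T' S') :
    IsAmpliation (ketE H) E ι π (T * T') (S * S') := by
  refine mul_of_mem_closure isKet_ketE hE hι (fun T₀ hT₀ => ?_) h hT
  obtain ⟨S₀, hS₀, hm⟩ := exists_of_mem_algTensor (π := π) hE hι hT₀
  exact ⟨S₀, hS₀, hm T' S' h'⟩

/-- The ampliations of the values of a `*`-homomorphism form a `*`-homomorphism, as soon as they
are multiplicative. -/
theorem exists_hom (hE : IsKet E) (hι : Function.Injective ι)
    (φ : 𝒜 →⋆ₙₐ[ℂ] (HilbTensor H K →L[ℂ] HilbTensor H K))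
    (hφ : ∀ a x y, ∃ c, ι c = (ketE H x).adjoint ∘L φ a ∘L ketE H y)
    (hmul : ∀ a a' S S', IsAmpliation (ketE H) E ι π (φ a) S →
      IsAmpliation (ketE H) E ι π (φ a') S' →
        IsAmpliation (ketE H) E ι π (φ a * φ a') (S * S')) :
    ∃ Φ : 𝒜 →⋆ₙₐ[ℂ] (Y →L[ℂ] Y), ∀ a, IsAmpliation (ketE H) E ι π (φ a) (Φ a) := by
  choose Φ hΦ using fun a => exists_of_slices (E₂ := E) (π := π) isKet_ketE hE hι (hφ a)
  refine ⟨{ toFun := Φ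
            map_smul' := fun c a => (hΦ (c • a)).unique hE hι ?_
            map_zero' := (hΦ 0).unique hE hι ?_
            map_add' := fun a a' => (hΦ (a + a')).unique hE hι ?_
            map_mul' := fun a a' => (hΦ (a * a')).unique hE hι ?_
            map_star' := fun a => (hΦ (Star.star a)).unique hE hι ?_ }, hΦ⟩
  · rw [map_smul]
    exact (hΦ a).smul c
  · rw [map_zero]
    exact zero
  · rw [map_add]
    exact (hΦ a).add (hΦ a')
  · rw [map_mul]
    exact hmul a a' _ _ (hΦ a) (hΦ a')
  · rw [map_star]
    exact (hΦ a).star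

end IsAmpliation

/-- A `*`-homomorphism is completely contractive: `∑ π aᵢ ⊗ bᵢ` is the ampliation of
`∑ ι aᵢ ⊗ bᵢ`. -/
theorem norm_sum_opTensor_le (hι : Function.Injective ι) (π : 𝒜 →⋆ₙₐ[ℂ] (X →L[ℂ] X))
    {κ : Type*} (F : Finset κ) (a : κ → 𝒜) (b : κ → K →L[ℂ] K) :
    ‖∑ i ∈ F, opTensor (π (a i)) (b i)‖ ≤ ‖∑ i ∈ F, opTensor (ι (a i)) (b i)‖ := by
  refine IsAmpliation.norm_le (E₁ := ketE H) (E₂ := ketE X) (π := π) isKet_ketE isKet_ketE hι ?_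
  exact IsAmpliation.sum F fun i _ =>
    IsAmpliation.opTensor_of_slice (adjoint_opTensor_ketE (π (a i)) (b i))

end AmpliationTensor

/-! ### Spatial tensor products of tensor powers -/

section SpatialPow

variable {H K X Y : Type*}
  [NormedAddCommGroup H] [InnerProductSpace ℂ H] [CompleteSpace H]
  [NormedAddCommGroup K] [InnerProductSpace ℂ K] [CompleteSpace K]
  [NormedAddCommGroup X] [InnerProductSpace ℂ X] [CompleteSpace X]
  [NormedAddCommGroup Y] [InnerProductSpace ℂ Y] [CompleteSpace Y]

/-- The operator with the slices of `R ⊗ b` depends continuously on `R`; hence a closed set that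
contains it for all `R ∈ D` contains it for all `R ∈ closure D`. -/
theorem IsKet.mem_of_slice {E : K → X →L[ℂ] Y} (hE : IsKet E) (b : K →L[ℂ] K)
    {Z : Set (Y →L[ℂ] Y)} (hZ : IsClosed Z) {D : Set (X →L[ℂ] X)}
    (hD : ∀ R ∈ D, ∃ S ∈ Z, ∀ x y, (E x).adjoint ∘L S ∘L E y = ⟪x, b y⟫_ℂ • R)
    {R : X →L[ℂ] X} (hR : R ∈ closure D) {S : Y →L[ℂ] Y}
    (hS : ∀ x y, (E x).adjoint ∘L S ∘L E y = ⟪x, b y⟫_ℂ • R) : S ∈ Z := by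
  let i : (X →L[ℂ] X) →⋆ₙₐ[ℂ] (X →L[ℂ] X) := NonUnitalStarAlgHom.id ℂ (X →L[ℂ] X)
  refine IsAmpliation.mem_of_mem_closure (𝒜 := X →L[ℂ] X) (ι := i) (π := i)
    (D := (fun R : X →L[ℂ] X => opTensor R b) '' D) isKet_ketE hE Function.injective_id hZ ?_
    (IsAmpliation.opTensor_of_slice hS)
    (image_closure_subset_closure_image (continuous_opTensor_left b) ⟨R, hR, rfl⟩)
  rintro _ ⟨R₀, hR₀, rfl⟩
  obtain ⟨S₀, hS₀, h₀⟩ := hD R₀ hR₀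
  exact ⟨S₀, hS₀, IsAmpliation.opTensor_of_slice (𝒜 := X →L[ℂ] X) (ι := i) (π := i) h₀⟩

/-- The operator `c ⊗ b` on `K^{⊗ (m+1)} = K^{⊗ m} ⊗ K`. -/
def snocOp {m : ℕ} (c : TensorPow K m →L[ℂ] TensorPow K m) (b : K →L[ℂ] K) :
    TensorPow K (m + 1) →L[ℂ] TensorPow K (m + 1) :=
  (opTensor c b : HilbTensor (TensorPow K m) K →L[ℂ] HilbTensor (TensorPow K m) K)

omit [CompleteSpace K] in
theorem snocOp_snocTensor {m : ℕ} (c : TensorPow K m →L[ℂ] TensorPow K m) (b : K →L[ℂ] K) (y : K)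
    (ξ : TensorPow K m) : snocOp c b (snocTensor m y ξ) = snocTensor m (b y) (c ξ) :=
  opTensor_apply_ketE c b y ξ

omit [CompleteSpace K] in
theorem snocOp_mem_spatialPow {m : ℕ} {c : TensorPow K m →L[ℂ] TensorPow K m}
    (hc : c ∈ spatialPow K m) (b : K →L[ℂ] K) : snocOp c b ∈ spatialPow K (m + 1) := by
  have h : (opTensor c b : HilbTensor (TensorPow K m) K →L[ℂ] HilbTensor (TensorPow K m) K) ∈
      spatialTensor (spatialPow K m : Set (TensorPow K m →L[ℂ] TensorPow K m)) Set.univ :=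
    Submodule.le_topologicalClosure _ (Submodule.subset_span ⟨c, hc, b, trivial, rfl⟩)
  exact h

omit [CompleteSpace H] [CompleteSpace K] in
theorem opTensor_snocOp_comp_ketEPow {m : ℕ} (v : H →L[ℂ] H)
    (c : TensorPow K m →L[ℂ] TensorPow K m) (b : K →L[ℂ] K) (y : K) :
    opTensor v (snocOp c b) ∘L ketEPow H m y = ketEPow H m (b y) ∘L opTensor v c := by
  refine isKet_ketE.ext_comp fun ξ => ?_
  ext u
  simp only [ketEPow, ContinuousLinearMap.comp_apply, opTensor_apply_ketE, snocOp_snocTensor]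
  rfl

omit [CompleteSpace H] in
/-- Reassociation `(V ⊗ B(K)^{⊗ m}) ⊗ B(K) ⊆ V ⊗ B(K)^{⊗ (m+1)}` on elementary tensors: if
`R ∈ V ⊗ B(K)^{⊗ m}`, then the operator on `H ⊗ K^{⊗ (m+1)}` with the slices of `R ⊗ b` lies in
`V ⊗ B(K)^{⊗ (m+1)}`. -/
theorem mem_spatialTensor_of_slice {V : Set (H →L[ℂ] H)} {m : ℕ}
    {R : HilbTensor H (TensorPow K m) →L[ℂ] HilbTensor H (TensorPow K m)}
    (hR : R ∈ spatialTensor V (spatialPow K m : Set (TensorPow K m →L[ℂ] TensorPow K m)))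
    {b : K →L[ℂ] K}
    {S : HilbTensor H (TensorPow K (m + 1)) →L[ℂ] HilbTensor H (TensorPow K (m + 1))}
    (hS : ∀ x y, (ketEPow H m x).adjoint ∘L S ∘L ketEPow H m y = ⟪x, b y⟫_ℂ • R) :
    S ∈ spatialTensor V
      (spatialPow K (m + 1) : Set (TensorPow K (m + 1) →L[ℂ] TensorPow K (m + 1))) := by
  refine (isKet_ketEPow m).mem_of_slice b (Submodule.isClosed_topologicalClosure _)
    (fun R hR => ?_) hR hS
  induction hR using Submodule.span_induction with
  | mem R hR =>
    obtain ⟨v, hv, c, hc, rfl⟩ := hR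
    refine ⟨opTensor v (snocOp c b), Submodule.le_topologicalClosure _ (Submodule.subset_span
      ⟨v, hv, _, snocOp_mem_spatialPow hc b, rfl⟩), fun x y => ?_⟩
    rw [opTensor_snocOp_comp_ketEPow]
    ext u
    simp [(isKet_ketEPow m).adjoint_apply]
  | zero => exact ⟨0, Submodule.zero_mem _, by simp⟩
  | add R₁ R₂ _ _ h₁ h₂ =>
    obtain ⟨S₁, hZ₁, hS₁⟩ := h₁
    obtain ⟨S₂, hZ₂, hS₂⟩ := h₂
    refine ⟨S₁ + S₂, Submodule.add_mem _ hZ₁ hZ₂, fun x y => ?_⟩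
    rw [smul_add, ← hS₁, ← hS₂, ContinuousLinearMap.add_comp, ContinuousLinearMap.comp_add]
  | smul c R _ h =>
    obtain ⟨S, hZ, hS⟩ := h
    refine ⟨c • S, Submodule.smul_mem _ c hZ, fun x y => ?_⟩
    rw [smul_comm, ← hS, ContinuousLinearMap.smul_comp, ContinuousLinearMap.comp_smul]

/-- If `π` takes values in `V ⊗ B(K)^{⊗ m}`, then its ampliation takes the spatial tensor product
with `B(K)` into `V ⊗ B(K)^{⊗ (m+1)}`. -/
theorem IsAmpliation.mem_spatialTensor {𝒜 : Type*} [NonUnitalCStarAlgebra 𝒜]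
    {ι : 𝒜 →⋆ₙₐ[ℂ] (H →L[ℂ] H)} (hι : Function.Injective ι) {V : Set (H →L[ℂ] H)} {m : ℕ}
    {π : 𝒜 →⋆ₙₐ[ℂ] (HilbTensor H (TensorPow K m) →L[ℂ] HilbTensor H (TensorPow K m))}
    (hπ : ∀ a, π a ∈ spatialTensor V (spatialPow K m : Set (TensorPow K m →L[ℂ] TensorPow K m)))
    {T : HilbTensor H K →L[ℂ] HilbTensor H K} (hT : T ∈ spatialTensor (Set.range ι) Set.univ)
    {S : HilbTensor H (TensorPow K (m + 1)) →L[ℂ] HilbTensor H (TensorPow K (m + 1))}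
    (h : IsAmpliation (ketE H) (ketEPow H m) ι π T S) :
    S ∈ spatialTensor V
      (spatialPow K (m + 1) : Set (TensorPow K (m + 1) →L[ℂ] TensorPow K (m + 1))) := by
  refine IsAmpliation.mem_of_mem_closure isKet_ketE (isKet_ketEPow m) hι
    (Submodule.isClosed_topologicalClosure _) (fun T hT => ?_) h hT
  induction hT using Submodule.span_induction with
  | mem T hT =>
    obtain ⟨_, ⟨a, rfl⟩, b, -, rfl⟩ := hT
    obtain ⟨S, hS⟩ := exists_of_opTensor (π := π) (isKet_ketEPow m) hι a b
    exact ⟨S, mem_spatialTensor_of_slice (hπ a) (hS.slice_of_opTensor hι), hS⟩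
  | zero => exact ⟨0, Submodule.zero_mem _, zero⟩
  | add T₁ T₂ _ _ h₁ h₂ =>
    obtain ⟨S₁, hZ₁, hS₁⟩ := h₁
    obtain ⟨S₂, hZ₂, hS₂⟩ := h₂
    exact ⟨S₁ + S₂, Submodule.add_mem _ hZ₁ hZ₂, hS₁.add hS₂⟩
  | smul c T _ h =>
    obtain ⟨S, hZ, hS⟩ := h
    exact ⟨c • S, Submodule.smul_mem _ c hZ, hS.smul c⟩

end SpatialPow

/-! ### The ultraweak topology -/

section Ultraweak

variable {H H' : Type*}
  [NormedAddCommGroup H] [InnerProductSpace ℂ H]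
  [NormedAddCommGroup H'] [InnerProductSpace ℂ H']

omit [InnerProductSpace ℂ H] in
theorem summable_norm_mul_norm {κ : Type*} {x y : κ → H} (hx : Summable fun n => ‖x n‖ ^ 2)
    (hy : Summable fun n => ‖y n‖ ^ 2) : Summable fun n => ‖x n‖ * ‖y n‖ :=
  (hx.add hy).of_nonneg_of_le (fun _ => by positivity) fun n => by
    nlinarith [sq_nonneg (‖x n‖ - ‖y n‖), sq_nonneg ‖x n‖, sq_nonneg ‖y n‖]

theorem summable_norm_sq_map {κ : Type*} {x : κ → H} (hx : Summable fun n => ‖x n‖ ^ 2)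
    (T : H →L[ℂ] H') : Summable fun n => ‖T (x n)‖ ^ 2 :=
  (hx.mul_left (‖T‖ ^ 2)).of_nonneg_of_le (fun n => by positivity) fun n => by
    rw [← mul_pow]
    gcongr
    exact T.le_opNorm _

theorem summable_inner_of_summable_norm_sq {κ : Type*} {x y : κ → H}
    (hx : Summable fun n => ‖x n‖ ^ 2) (hy : Summable fun n => ‖y n‖ ^ 2) :
    Summable fun n => ⟪x n, y n⟫_ℂ :=
  .of_norm_bounded (summable_norm_mul_norm hx hy) fun _ => norm_inner_le_norm _ _

theorem continuous_ultraweak_tsum_nat {x y : ℕ → H} (hx : Summable fun n => ‖x n‖ ^ 2)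
    (hy : Summable fun n => ‖y n‖ ^ 2) :
    @Continuous _ _ (ultraweakTopology H) inferInstance
      fun T : H →L[ℂ] H => ∑' n, ⟪x n, T (y n)⟫_ℂ :=
  continuous_iff_le_induced.2 <| iInf_le_of_le x <| iInf_le_of_le y <| iInf_le_of_le hx <|
    iInf_le_of_le hy le_rfl

theorem continuous_ultraweak_tsum {κ : Type*} [Countable κ] {x y : κ → H}
    (hx : Summable fun n => ‖x n‖ ^ 2) (hy : Summable fun n => ‖y n‖ ^ 2) :
    @Continuous _ _ (ultraweakTopology H) inferInstance
      fun T : H →L[ℂ] H => ∑' n, ⟪x n, T (y n)⟫_ℂ := by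
  obtain ⟨f, hf⟩ := Countable.exists_injective_nat κ
  have hext : ∀ {w : κ → H}, (Summable fun n => ‖w n‖ ^ 2) →
      Summable fun n => ‖Function.extend f w 0 n‖ ^ 2 := by
    intro w hw
    refine (hf.summable_iff fun _ hn => ?_).1 ?_
    · rw [Function.extend_apply' _ _ _ (by simpa using hn)]
      simp
    · simpa [Function.comp_def, hf.extend_apply] using hw
  have h := continuous_ultraweak_tsum_nat (hext hx) (hext hy)
  convert h using 2 with T
  rw [← hf.tsum_eq]
  · simp [hf.extend_apply]
  · intro n hn
    by_contra hn'
    refine hn ?_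
    beta_reduce
    rw [Function.extend_apply' _ _ _ (by simpa using hn'), Pi.zero_apply, inner_zero_left]

theorem continuous_to_ultraweak {α : Type*} [TopologicalSpace α] {f : α → H →L[ℂ] H} :
    @Continuous _ _ _ (ultraweakTopology H) f ↔
      ∀ x y : ℕ → H, (Summable fun n => ‖x n‖ ^ 2) → (Summable fun n => ‖y n‖ ^ 2) →
        Continuous fun a => ∑' n, ⟪x n, f a (y n)⟫_ℂ := by
  simp only [continuous_iInf_rng, continuous_induced_rng]
  rfl

/-- On norm-bounded sets weak convergence implies ultraweak convergence. -/
theorem tendsto_ultraweak_of_bounded {α : Type*} {l : Filter α} {T : α → H →L[ℂ] H}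
    {T₀ : H →L[ℂ] H} {C : ℝ} (hC : ∀ i, ‖T i‖ ≤ C)
    (h : ∀ x y, Tendsto (fun i => ⟪x, T i y⟫_ℂ) l (𝓝 ⟪x, T₀ y⟫_ℂ)) :
    Tendsto T l (@nhds _ (ultraweakTopology H) T₀) := by
  simp only [nhds_iInf, nhds_induced, tendsto_iInf, tendsto_comap_iff]
  intro x y hx hy
  refine tendsto_tsum_of_dominated_convergence ((summable_norm_mul_norm hx hy).mul_left C)
    (fun n => h (x n) (y n)) (Eventually.of_forall fun i n => ?_)
  refine (norm_inner_le_norm _ _).trans ?_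
  calc ‖x n‖ * ‖T i (y n)‖ ≤ ‖x n‖ * (C * ‖y n‖) := by
        gcongr
        exact (T i).le_of_opNorm_le (hC i) _
    _ = C * (‖x n‖ * ‖y n‖) := by ring

/-- Conjugation `T ↦ V* T W` by bounded operators is ultraweakly continuous. -/
theorem continuous_ultraweak_conj [CompleteSpace H] [CompleteSpace H'] (V W : H →L[ℂ] H') :
    @Continuous _ _ (ultraweakTopology H') (ultraweakTopology H)
      fun T : H' →L[ℂ] H' => V.adjoint ∘L T ∘L W := by
  let _ := ultraweakTopology H'
  refine continuous_to_ultraweak.2 fun x y hx hy => ?_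
  simpa [ContinuousLinearMap.adjoint_inner_right] using
    continuous_ultraweak_tsum_nat (summable_norm_sq_map hx V) (summable_norm_sq_map hy W)

/-- Every ultraweak neighbourhood of `0` contains all `T* T` with `∑ ‖T zₙ‖² ≤ 1`, for a suitable
square-summable sequence `z`. -/
theorem exists_of_mem_nhds_ultraweak [CompleteSpace H] {s : Set (H →L[ℂ] H)}
    (hs : s ∈ @nhds _ (ultraweakTopology H) 0) :
    ∃ z : ℕ → H, (Summable fun n => ‖z n‖ ^ 2) ∧
      ∀ T : H →L[ℂ] H, ∑' n, ‖T (z n)‖ ^ 2 ≤ 1 → star T * T ∈ s := by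
  -- two sequences can be merged into a single one
  have merge : ∀ {z₁ z₂ : ℕ → H}, (Summable fun n => ‖z₁ n‖ ^ 2) →
      (Summable fun n => ‖z₂ n‖ ^ 2) → ∃ z : ℕ → H, (Summable fun n => ‖z n‖ ^ 2) ∧
        ∀ T : H →L[ℂ] H, ∑' n, ‖T (z₁ n)‖ ^ 2 ≤ ∑' n, ‖T (z n)‖ ^ 2 ∧
          ∑' n, ‖T (z₂ n)‖ ^ 2 ≤ ∑' n, ‖T (z n)‖ ^ 2 := by
    intro z₁ z₂ h₁ h₂
    let e := Equiv.natSumNatEquivNat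
    have hsum : Summable fun n => ‖Sum.elim z₁ z₂ (e.symm n)‖ ^ 2 :=
      e.symm.summable_iff (f := fun i => ‖Sum.elim z₁ z₂ i‖ ^ 2) |>.2
        (Summable.sum _ (by simpa [Function.comp_def] using h₁)
          (by simpa [Function.comp_def] using h₂))
    refine ⟨fun n => Sum.elim z₁ z₂ (e.symm n), hsum, fun T => ⟨?_, ?_⟩⟩
    · have := tsum_comp_le_tsum_of_inj (summable_norm_sq_map hsum T) (fun n => by positivity)
        (e.injective.comp Sum.inl_injective)
      simpa [Function.comp_def] using this
    · have := tsum_comp_le_tsum_of_inj (summable_norm_sq_map hsum T) (fun n => by positivity)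
        (e.injective.comp Sum.inr_injective)
      simpa [Function.comp_def] using this
  let 𝓕 : Filter (H →L[ℂ] H) :=
    { sets := {s | ∃ z : ℕ → H, (Summable fun n => ‖z n‖ ^ 2) ∧
        ∀ T : H →L[ℂ] H, ∑' n, ‖T (z n)‖ ^ 2 ≤ 1 → star T * T ∈ s}
      univ_sets := ⟨0, by simp, fun T _ => trivial⟩
      sets_of_superset := fun ⟨z, hz, h⟩ hst => ⟨z, hz, fun T hT => hst (h T hT)⟩
      inter_sets := by
        rintro s t ⟨z₁, hz₁, h₁⟩ ⟨z₂, hz₂, h₂⟩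
        obtain ⟨z, hz, h⟩ := merge hz₁ hz₂
        exact ⟨z, hz, fun T hT => ⟨h₁ T ((h T).1.trans hT), h₂ T ((h T).2.trans hT)⟩⟩ }
  suffices h𝓕 : 𝓕 ≤ @nhds _ (ultraweakTopology H) 0 from h𝓕 hs
  simp only [nhds_iInf, nhds_induced, le_iInf_iff]
  intro x y hx hy t ht
  obtain ⟨u, hu, hut⟩ := ht
  simp only [zero_apply, inner_zero_right, tsum_zero] at hu
  obtain ⟨ε, hε, hball⟩ := Metric.mem_nhds_iff.1 hu
  -- the scaling is chosen so that `∑ ‖T zₙ‖² ≤ 1` forces `∑ ‖T xₙ‖², ∑ ‖T yₙ‖² ≤ ε / 2`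
  let c : ℝ := √(2 / ε)
  have hc : c ^ 2 = 2 / ε := Real.sq_sqrt (by positivity)
  have hscale : ∀ {w : ℕ → H}, (Summable fun n => ‖w n‖ ^ 2) →
      Summable fun n => ‖((c : ℂ) • w n : H)‖ ^ 2 := fun hw => by
    simpa [norm_smul, mul_pow] using hw.mul_left (c ^ 2)
  obtain ⟨z, hz, h⟩ := merge (hscale hx) (hscale hy)
  refine ⟨z, hz, fun T hT => hut (hball ?_)⟩
  have hTs : ∀ {w : ℕ → H}, ∑' n, ‖T ((c : ℂ) • w n)‖ ^ 2 ≤ 1 → ∑' n, ‖T (w n)‖ ^ 2 ≤ ε / 2 := by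
    intro w hw
    simp only [map_smul, norm_smul, mul_pow, tsum_mul_left, Complex.norm_real, Real.norm_eq_abs,
      sq_abs, hc] at hw
    rw [div_mul_eq_mul_div, div_le_one hε] at hw
    linarith
  have h1 := hTs ((h T).1.trans hT)
  have h2 := hTs ((h T).2.trans hT)
  have hTx := summable_norm_sq_map hx T
  have hTy := summable_norm_sq_map hy T
  have hbound : ‖∑' n, ⟪x n, (star T * T) (y n)⟫_ℂ‖ ≤
      ∑' n, (‖T (x n)‖ ^ 2 + ‖T (y n)‖ ^ 2) / 2 := by
    refine tsum_of_norm_bounded ((hTx.add hTy).div_const 2).hasSum fun n => ?_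
    rw [mul_apply_eq_comp, ContinuousLinearMap.star_eq_adjoint,
      ContinuousLinearMap.adjoint_inner_right]
    refine (norm_inner_le_norm _ _).trans ?_
    nlinarith [sq_nonneg (‖T (x n)‖ - ‖T (y n)‖)]
  rw [tsum_div_const, hTx.tsum_add hTy] at hbound
  rw [mem_ball_zero_iff]
  linarith

/-- A positive ultraweakly continuous functional is dominated by a vector sum `∑ ⟨zₙ, · zₙ⟩`. -/
theorem exists_forall_norm_le_of_continuous_ultraweak {𝒜 : Type*} [NonUnitalCStarAlgebra 𝒜]
    [CompleteSpace H] (ι : 𝒜 →⋆ₙₐ[ℂ] (H →L[ℂ] H)) (ω : 𝒜 →ₗ[ℂ] ℂ)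
    (hω : @Continuous _ _ ((ultraweakTopology H).induced ι) inferInstance ω) :
    ∃ z : ℕ → H, (Summable fun n => ‖z n‖ ^ 2) ∧
      ∀ a, ‖ω (star a * a)‖ ≤ ∑' n, ‖ι a (z n)‖ ^ 2 := by
  have hmem : {a | ‖ω a‖ < 1} ∈ @nhds _ ((ultraweakTopology H).induced ι) 0 := by
    have h0 : {w : ℂ | ‖w‖ < 1} ∈ 𝓝 (ω 0) := by
      rw [map_zero]
      exact (isOpen_lt continuous_norm continuous_const).mem_nhds (by simp)
    exact (@Continuous.tendsto _ _ ((ultraweakTopology H).induced ι) _ _ hω 0) h0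
  rw [@nhds_induced _ _ (ultraweakTopology H) ι 0, map_zero] at hmem
  obtain ⟨s, hs, hsub⟩ := hmem
  obtain ⟨z, hz, h⟩ := exists_of_mem_nhds_ultraweak hs
  refine ⟨z, hz, fun a => le_of_forall_gt_imp_ge_of_dense fun δ hδ => ?_⟩
  have hδ0 : 0 < δ := lt_of_le_of_lt (tsum_nonneg fun n => by positivity) hδ
  let r : ℝ := √(1 / δ)
  have hr : r ^ 2 = 1 / δ := Real.sq_sqrt (by positivity)
  have hle : ∑' n, ‖ι ((r : ℂ) • a) (z n)‖ ^ 2 ≤ 1 := by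
    simp only [map_smul, smul_apply, norm_smul, mul_pow, tsum_mul_left, Complex.norm_real,
      Real.norm_eq_abs, sq_abs, hr]
    rw [one_div_mul_eq_div, div_le_one hδ0]
    exact hδ.le
  have hlt : star ((r : ℂ) • a) * ((r : ℂ) • a) ∈ {a | ‖ω a‖ < 1} := by
    refine hsub ?_
    rw [Set.mem_preimage, map_mul, map_star]
    exact h _ hle
  have heq : star ((r : ℂ) • a) * ((r : ℂ) • a) = ((r ^ 2 : ℝ) : ℂ) • (star a * a) := by
    rw [star_smul, smul_mul_smul_comm]
    simp [sq]
  rw [heq, Set.mem_ofPred_eq, map_smul, norm_smul, Complex.norm_real, hr, Real.norm_eq_abs,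
    abs_of_pos (by positivity), one_div_mul_eq_div, div_lt_one hδ0] at hlt
  exact hlt.le

end Ultraweak

/-! ### Normal representations -/

section Normal

variable {𝒜 : Type*} [NonUnitalCStarAlgebra 𝒜] {H K G L : Type*}
  [NormedAddCommGroup H] [InnerProductSpace ℂ H] [CompleteSpace H]
  [NormedAddCommGroup K] [InnerProductSpace ℂ K] [CompleteSpace K]
  [NormedAddCommGroup G] [InnerProductSpace ℂ G] [CompleteSpace G]
  [NormedAddCommGroup L] [InnerProductSpace ℂ L] [CompleteSpace L]

theorem adjoint_ketE_opTensor_one_apply (T : H →L[ℂ] H) (x : K) (w : HilbTensor H K) :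
    (ketE H x).adjoint (opTensor T 1 w) = T ((ketE H x).adjoint w) := by
  have h1 : (1 : K →L[ℂ] K).adjoint = 1 := star_one _
  have h := isKet_ketE.adjoint_comp_of_slice (adjoint_opTensor_ketE (K := K) T 1) x
  rw [h1] at h
  exact congrArg (fun f => f w) h

/-- The amplification `T ↦ T ⊗ 1` on `H ⊗ K` is normal if `K` is separable. -/
theorem continuous_ultraweak_amplify {κ : Type*} [Countable κ] (b : HilbertBasis κ ℂ K) :
    @Continuous _ _ (ultraweakTopology H) (ultraweakTopology (HilbTensor H K)) (amplify H K) := by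
  let _ := ultraweakTopology H
  refine continuous_to_ultraweak.2 fun x y hx hy => ?_
  have hsum : ∀ {w : ℕ → HilbTensor H K}, (Summable fun n => ‖w n‖ ^ 2) →
      Summable fun p : ℕ × κ => ‖(ketE H (b p.2)).adjoint (w p.1)‖ ^ 2 := by
    intro w hw
    refine (summable_prod_of_nonneg fun p => by positivity).2
      ⟨fun n => (isKet_ketE.hasSum_norm_sq_coord b (w n)).summable, ?_⟩
    exact hw.congr fun n => ((isKet_ketE.hasSum_norm_sq_coord b (w n)).tsum_eq).symm
  refine (continuous_ultraweak_tsum (hsum hx) (hsum hy)).congr fun T => ?_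
  have hs : Summable fun p : ℕ × κ =>
      ⟪(ketE H (b p.2)).adjoint (x p.1), T ((ketE H (b p.2)).adjoint (y p.1))⟫_ℂ :=
    summable_inner_of_summable_norm_sq (hsum hx) (summable_norm_sq_map (hsum hy) T)
  rw [hs.tsum_prod]
  refine tsum_congr fun n => ?_
  rw [← (isKet_ketE.hasSum_inner_coord b (x n) (amplify H K T (y n))).tsum_eq]
  simp only [amplify_apply, adjoint_ketE_opTensor_one_apply]

/-- If the vector functional of `ξ` in the representation `ρ` is dominated by that of `z` in the
representation `α`, then `α a z ↦ ρ a ξ` extends to a contractive intertwiner. -/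
theorem exists_intertwiner (α : 𝒜 →⋆ₙₐ[ℂ] (G →L[ℂ] G)) (ρ : 𝒜 →⋆ₙₐ[ℂ] (L →L[ℂ] L)) (z : G) (ξ : L)
    (h : ∀ a, ‖ρ a ξ‖ ≤ ‖α a z‖) :
    ∃ W : G →L[ℂ] L, ‖W‖ ≤ 1 ∧ (∀ a, W (α a z) = ρ a ξ) ∧ ∀ a, W ∘L α a = ρ a ∘L W := by
  let f : 𝒜 →ₗ[ℂ] L :=
    { toFun := fun a => ρ a ξ
      map_add' := fun a c => by simp
      map_smul' := fun c a => by simp }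
  let g : 𝒜 →ₗ[ℂ] G :=
    { toFun := fun a => α a z
      map_add' := fun a c => by simp
      map_smul' := fun c a => by simp }
  let C := g.range.topologicalClosure
  have hgC : ∀ a, g a ∈ C := fun a => Submodule.le_topologicalClosure _ ⟨a, rfl⟩
  have : CompleteSpace C := (Submodule.isClosed_topologicalClosure _).completeSpace_coe
  let e : 𝒜 →ₗ[ℂ] C := g.codRestrict C hgC
  have hdense : DenseRange e := by
    intro c
    rw [closure_subtype, ← Set.range_comp]
    exact c.2
  have hle : ∀ a, ‖f a‖ ≤ 1 * ‖e a‖ := fun a => by simpa [e] using! h a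
  let W := f.extendOfNorm e ∘L C.orthogonalProjectionOnto
  have hW : ∀ a, W (g a) = f a := by
    intro a
    have : C.orthogonalProjectionOnto (g a) = e a :=
      C.orthogonalProjectionOnto_mem_subspace_eq_self (e a)
    rw [ContinuousLinearMap.comp_apply, this, LinearMap.extendOfNorm_eq hdense ⟨1, hle⟩]
  have hWP : W ∘L C.starProjection = W := by
    ext w
    have : C.orthogonalProjectionOnto (C.starProjection w) = C.orthogonalProjectionOnto w :=
      C.orthogonalProjectionOnto_mem_subspace_eq_self (C.orthogonalProjectionOnto w)
    simp [W, this]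
  -- on the closure of `α(𝒜) z` the intertwining relation follows from the dense part
  have hWC : ∀ a, ∀ c ∈ C, W (α a c) = ρ a (W c) := by
    intro a c hc
    have hclosed : IsClosed {c | W (α a c) = ρ a (W c)} :=
      isClosed_eq (by fun_prop) (by fun_prop)
    refine closure_minimal ?_ hclosed hc
    rintro _ ⟨a', rfl⟩
    have h1 : α a (g a') = g (a * a') := by simp [g]
    rw [Set.mem_ofPred_eq, h1, hW, hW]
    simp [f]
  have hinv : ∀ a, ∀ c ∈ C, α a c ∈ C := by
    intro a c hc
    have hclosed : IsClosed {c | α a c ∈ C} :=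
      (Submodule.isClosed_topologicalClosure _).preimage (α a).continuous
    refine closure_minimal ?_ hclosed hc
    rintro _ ⟨a', rfl⟩
    have h1 : α a (g a') = g (a * a') := by simp [g]
    rw [Set.mem_ofPred_eq, h1]
    exact hgC _
  have hPαP : ∀ a, C.starProjection ∘L α a ∘L C.starProjection = α a ∘L C.starProjection := by
    intro a
    ext w
    exact C.starProjection_eq_self_iff.2 (hinv a _ (C.starProjection_apply_mem w))
  have hPα : ∀ a, C.starProjection ∘L α a = C.starProjection ∘L α a ∘L C.starProjection := by
    intro a
    have h1 := congrArg ContinuousLinearMap.adjoint (hPαP (star a))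
    have h2 : (C.starProjection).adjoint = C.starProjection :=
      (isSelfAdjoint_starProjection C).star_eq
    rw [map_star, ContinuousLinearMap.star_eq_adjoint] at h1
    simp only [ContinuousLinearMap.adjoint_comp, ContinuousLinearMap.adjoint_adjoint, h2] at h1
    rw [← h1, ContinuousLinearMap.comp_assoc]
  refine ⟨W, ?_, hW, fun a => ?_⟩
  · calc ‖W‖ ≤ ‖f.extendOfNorm e‖ * ‖C.orthogonalProjectionOnto‖ :=
          ContinuousLinearMap.opNorm_comp_le _ _
      _ ≤ 1 * 1 := by
        gcongr
        · exact LinearMap.opNorm_extendOfNorm_le hdense zero_le_one hle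
        · exact C.orthogonalProjectionOnto_norm_le
      _ = 1 := one_mul 1
  · calc W ∘L α a = W ∘L (C.starProjection ∘L α a) := by
          rw [← ContinuousLinearMap.comp_assoc, hWP]
      _ = W ∘L (C.starProjection ∘L (α a ∘L C.starProjection)) := by rw [hPα]
      _ = (W ∘L α a) ∘L C.starProjection := by
          rw [← ContinuousLinearMap.comp_assoc W, hWP]
          rfl
      _ = ρ a ∘L (W ∘L C.starProjection) := by
          ext w
          exact hWC a _ (C.starProjection_apply_mem w)
      _ = ρ a ∘L W := by rw [hWP]

/-- A vector functional of `ρ` that is dominated by a vector functional of `α` is equal to one: the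
vector is `|W| z` for the intertwiner `W`, since `|W|` commutes with `α(𝒜)`. -/
theorem exists_vector_of_dominated (α : 𝒜 →⋆ₙₐ[ℂ] (G →L[ℂ] G)) (ρ : 𝒜 →⋆ₙₐ[ℂ] (L →L[ℂ] L)) (z : G)
    (ξ : L) (h : ∀ a, ‖ρ a ξ‖ ≤ ‖α a z‖) : ∃ η : G, ∀ a, ‖α a η‖ = ‖ρ a ξ‖ := by
  obtain ⟨W, -, hW, hint⟩ := exists_intertwiner α ρ z ξ h
  let R := CFC.sqrt (W.adjoint ∘L W)
  have hpos : 0 ≤ W.adjoint ∘L W :=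
    (ContinuousLinearMap.nonneg_iff_isPositive _).2
      (ContinuousLinearMap.isPositive_adjoint_comp_self W)
  have hRR : R * R = W.adjoint ∘L W := CFC.sqrt_mul_sqrt_self _ hpos
  have hRsa : R.adjoint = R := (IsSelfAdjoint.of_nonneg (CFC.sqrt_nonneg _)).star_eq
  have hnorm : ∀ w, ‖R w‖ = ‖W w‖ := by
    intro w
    have h1 : ⟪R w, R w⟫_ℂ = ⟪W w, W w⟫_ℂ := by
      rw [← ContinuousLinearMap.adjoint_inner_right, hRsa,
        ← ContinuousLinearMap.adjoint_inner_right W]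
      exact congrArg (fun T : G →L[ℂ] G => ⟪w, T w⟫_ℂ) hRR
    rw [inner_self_eq_norm_sq_to_K, inner_self_eq_norm_sq_to_K] at h1
    have h2 : ‖R w‖ ^ 2 = ‖W w‖ ^ 2 := by exact_mod_cast h1
    exact (pow_left_inj₀ (norm_nonneg _) (norm_nonneg _) two_ne_zero).1 h2
  have hcomm : ∀ a, Commute R (α a) := by
    intro a
    refine Commute.cfcₙ_nnreal ?_ _
    have h1 : α a ∘L W.adjoint = W.adjoint ∘L ρ a := by
      have := congrArg ContinuousLinearMap.adjoint (hint (star a))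
      simpa [ContinuousLinearMap.adjoint_comp, map_star, ContinuousLinearMap.star_eq_adjoint]
        using this
    change (W.adjoint ∘L W) ∘L α a = α a ∘L (W.adjoint ∘L W)
    rw [ContinuousLinearMap.comp_assoc, hint, ← ContinuousLinearMap.comp_assoc, ← h1,
      ContinuousLinearMap.comp_assoc]
  refine ⟨R z, fun a => ?_⟩
  have h1 : α a (R z) = R (α a z) := congrArg (fun T : G →L[ℂ] G => T z) (hcomm a).eq.symm
  rw [h1, hnorm, hW]

variable {ι : 𝒜 →⋆ₙₐ[ℂ] (H →L[ℂ] H)}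

/-- The separable amplification space `H ⊗ ℓ²`. -/
abbrev AmpSpace (H : Type*) [NormedAddCommGroup H] [InnerProductSpace ℂ H] : Type _ :=
  HilbTensor H (lp (fun _ : ℕ => ℂ) 2)

/-- The representation `a ↦ ι a ⊗ 1` on `H ⊗ ℓ²`. -/
def ampRep (ι : 𝒜 →⋆ₙₐ[ℂ] (H →L[ℂ] H)) : 𝒜 →⋆ₙₐ[ℂ] (AmpSpace H →L[ℂ] AmpSpace H) :=
  (amplify H (lp (fun _ : ℕ => ℂ) 2)).comp ι

/-- The standard basis of `ℓ²`. -/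
def stdBasis : HilbertBasis ℕ ℂ (lp (fun _ : ℕ => ℂ) 2) :=
  HilbertBasis.ofRepr (LinearIsometryEquiv.refl ℂ _)

/-- The matrix coefficients of a vector `ξ` with ultraweakly continuous vector functional are those
of `H ⊗ ℓ²`, with control of the norms. -/
theorem exists_intertwiner_of_continuous (hι : Function.Injective ι) {e : 𝒜} (he : ι e = 1)
    (ρ : 𝒜 →⋆ₙₐ[ℂ] (L →L[ℂ] L)) {ξ : L}
    (hξ : @Continuous _ _ ((ultraweakTopology H).induced ι) inferInstance fun a => ⟪ξ, ρ a ξ⟫_ℂ) :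
    ∃ (U : AmpSpace H →L[ℂ] L) (η : AmpSpace H), ‖U‖ ≤ 1 ∧ ‖η‖ ≤ ‖ξ‖ ∧
      ∀ a, U (ampRep ι a η) = ρ a ξ := by
  let ω : 𝒜 →ₗ[ℂ] ℂ :=
    { toFun := fun a => ⟪ξ, ρ a ξ⟫_ℂ
      map_add' := fun a c => by simp
      map_smul' := fun c a => by simp }
  obtain ⟨z, hz, hdom⟩ := exists_forall_norm_le_of_continuous_ultraweak ι ω hξ
  obtain ⟨w, hw⟩ := isKet_ketE.exists_coord_eq (X := H) (Y := AmpSpace H) stdBasis z hz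
  have hle : ∀ a, ‖ρ a ξ‖ ≤ ‖ampRep ι a w‖ := by
    intro a
    have h1 : ‖ω (star a * a)‖ = ‖ρ a ξ‖ ^ 2 := by
      have : ω (star a * a) = ⟪ρ a ξ, ρ a ξ⟫_ℂ := by
        simp [ω, map_mul, map_star, ContinuousLinearMap.star_eq_adjoint,
          ContinuousLinearMap.adjoint_inner_right]
      rw [this, inner_self_eq_norm_sq_to_K]
      simp
    have h2 : ‖ampRep ι a w‖ ^ 2 = ∑' n, ‖ι a (z n)‖ ^ 2 := by
      rw [← (isKet_ketE.hasSum_norm_sq_coord stdBasis (ampRep ι a w)).tsum_eq]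
      refine tsum_congr fun n => ?_
      rw [← hw n, ← adjoint_ketE_opTensor_one_apply]
      rfl
    have h3 := hdom a
    rw [h1, ← h2] at h3
    exact (pow_le_pow_iff_left₀ (norm_nonneg _) (norm_nonneg _) two_ne_zero).1 h3
  obtain ⟨η, hη⟩ := exists_vector_of_dominated (ampRep ι) ρ w ξ hle
  obtain ⟨U, hU, hUη, -⟩ := exists_intertwiner (ampRep ι) ρ η ξ fun a => (hη a).ge
  refine ⟨U, η, hU, ?_, hUη⟩
  have h1 : ampRep ι e = 1 := by
    refine isKet_ketE.ext_comp fun x => ?_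
    ext u
    simp [ampRep, he, opTensor_ketE]
  have h2 := hη e
  rw [h1, one_apply_eq_self] at h2
  -- `ρ e` is contractive because `‖e‖ = ‖ι e‖ = ‖1‖ ≤ 1`
  rw [h2]
  refine ((ρ e).le_opNorm ξ).trans (mul_le_of_le_one_left (norm_nonneg _) ?_)
  refine (NonUnitalStarAlgHom.norm_apply_le ρ e).trans ?_
  rw [← NonUnitalStarAlgHom.norm_map ι hι, he]
  exact ContinuousLinearMap.norm_id_le

end Normal

section Normal

variable {𝒜 : Type*} [NonUnitalCStarAlgebra 𝒜] {H K X Y L : Type*}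
  [NormedAddCommGroup H] [InnerProductSpace ℂ H] [CompleteSpace H]
  [NormedAddCommGroup K] [InnerProductSpace ℂ K] [CompleteSpace K]
  [NormedAddCommGroup X] [InnerProductSpace ℂ X] [CompleteSpace X]
  [NormedAddCommGroup Y] [InnerProductSpace ℂ Y] [CompleteSpace Y]
  [NormedAddCommGroup L] [InnerProductSpace ℂ L] [CompleteSpace L]
  {ι : 𝒜 →⋆ₙₐ[ℂ] (H →L[ℂ] H)}

/-- A representation `π` of `𝒜` is normal relative to the faithful representation `ι` if it is
continuous for the ultraweak topologies, that of `𝒜` being induced by `ι`. -/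
def IsNormalRep (ι : 𝒜 →⋆ₙₐ[ℂ] (H →L[ℂ] H)) (π : 𝒜 → X →L[ℂ] X) : Prop :=
  @Continuous _ _ ((ultraweakTopology H).induced ι) (ultraweakTopology X) π

theorem continuous_tsum_ampRep (x y : ℕ → AmpSpace H) (hx : Summable fun n => ‖x n‖ ^ 2)
    (hy : Summable fun n => ‖y n‖ ^ 2) :
    @Continuous _ _ ((ultraweakTopology H).induced ι) inferInstance
      fun a => ∑' n, ⟪x n, ampRep ι a (y n)⟫_ℂ := by
  let _ := (ultraweakTopology H).induced ι
  let _ := ultraweakTopology H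
  let _ := ultraweakTopology (AmpSpace H)
  have h1 : Continuous ι := continuous_induced_dom
  have h2 : Continuous (amplify H (lp (fun _ : ℕ => ℂ) 2)) := continuous_ultraweak_amplify stdBasis
  exact (continuous_ultraweak_tsum_nat hx hy).comp (h2.comp h1)

theorem continuous_inner_ampRep (x y : AmpSpace H) :
    @Continuous _ _ ((ultraweakTopology H).induced ι) inferInstance
      fun a => ⟪x, ampRep ι a y⟫_ℂ := by
  let _ := (ultraweakTopology H).induced ι
  let _ := ultraweakTopology H
  let _ := ultraweakTopology (AmpSpace H)
  have h1 : Continuous ι := continuous_induced_dom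
  have h2 : Continuous (amplify H (lp (fun _ : ℕ => ℂ) 2)) := continuous_ultraweak_amplify stdBasis
  exact (continuous_ultraweak_inner x y).comp (h2.comp h1)

/-- The vectors `ξ` for which all the coefficients `⟨ζ, ρ(·) ξ⟩` are ultraweakly continuous. -/
def normalVectors (ι : 𝒜 →⋆ₙₐ[ℂ] (H →L[ℂ] H)) (ρ : 𝒜 →⋆ₙₐ[ℂ] (L →L[ℂ] L)) : Submodule ℂ L where
  carrier := {ξ | ∀ ζ, @Continuous _ _ ((ultraweakTopology H).induced ι) inferInstance
    fun a => ⟪ζ, ρ a ξ⟫_ℂ}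
  zero_mem' ζ := by
    let _ := (ultraweakTopology H).induced ι
    simpa using continuous_const
  add_mem' h h' ζ := by
    let _ := (ultraweakTopology H).induced ι
    refine ((h ζ).add (h' ζ)).congr fun a => ?_
    simp
  smul_mem' c ξ h ζ := by
    let _ := (ultraweakTopology H).induced ι
    simpa [inner_smul_right] using (h ζ).const_mul c

/-- Continuity of the diagonal coefficient of `ξ` implies that of all coefficients of `ξ`. -/
theorem mem_normalVectors_of_continuous (hι : Function.Injective ι) {e : 𝒜} (he : ι e = 1)
    (ρ : 𝒜 →⋆ₙₐ[ℂ] (L →L[ℂ] L)) {ξ : L}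
    (hξ : @Continuous _ _ ((ultraweakTopology H).induced ι) inferInstance fun a => ⟪ξ, ρ a ξ⟫_ℂ) :
    ξ ∈ normalVectors ι ρ := by
  obtain ⟨U, η, -, -, hU⟩ := exists_intertwiner_of_continuous hι he ρ hξ
  intro ζ
  refine Eq.mp ?_ (continuous_inner_ampRep (ι := ι) (U.adjoint ζ) η)
  congr 1
  ext a
  rw [ContinuousLinearMap.adjoint_inner_left, hU]

/-- The normal vectors form a closed subspace: the limit of a rapidly converging series of normal
vectors has coefficients given by a single square-summable pair of sequences in `H ⊗ ℓ²`. -/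
theorem isClosed_normalVectors (hι : Function.Injective ι) {e : 𝒜} (he : ι e = 1)
    (ρ : 𝒜 →⋆ₙₐ[ℂ] (L →L[ℂ] L)) : IsClosed (normalVectors ι ρ : Set L) := by
  refine isClosed_of_closure_subset fun ξ hξ ζ => ?_
  obtain ⟨v, hv, hmem, -, hb⟩ := controlled_sum_of_mem_closure
    (s := (normalVectors ι ρ).toAddSubgroup) hξ (b := fun n => (1 / 4 : ℝ) ^ n)
    (fun n => by positivity)
  choose U η hU hη hUη using fun n =>
    exists_intertwiner_of_continuous hι he ρ (ξ := v n) (hmem n (v n))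
  -- `‖U n‖ ≤ 1` and `‖η n‖ ≤ 4⁻ⁿ`, so the weights `2⁻ⁿ` and `2ⁿ` make both sequences summable
  let x : ℕ → AmpSpace H := fun n => ((1 / 2 : ℝ) ^ n : ℂ) • (U n).adjoint ζ
  let y : ℕ → AmpSpace H := fun n => ((2 : ℝ) ^ n : ℂ) • η n
  have hgeo : Summable fun n : ℕ => ((1 / 2 : ℝ) ^ n) ^ 2 := by
    simp_rw [← pow_mul, mul_comm _ 2, pow_mul]
    exact summable_geometric_of_lt_one (by norm_num) (by norm_num)
  have hx : Summable fun n => ‖x n‖ ^ 2 := by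
    refine (hgeo.mul_right (‖ζ‖ ^ 2)).of_nonneg_of_le (fun n => by positivity) fun n => ?_
    rw [← mul_pow, norm_smul]
    gcongr
    · simp
    · refine ((U n).adjoint.le_opNorm ζ).trans (mul_le_of_le_one_left (norm_nonneg _) ?_)
      rw [LinearIsometryEquiv.norm_map]
      exact hU n
  have hy : Summable fun n => ‖y n‖ ^ 2 := by
    refine (summable_nat_add_iff 1).1 (((summable_nat_add_iff 1).2 hgeo).of_nonneg_of_le
      (fun n => by positivity) fun n => ?_)
    rw [norm_smul]
    gcongr
    calc ‖(((2 : ℝ) ^ (n + 1) : ℂ))‖ * ‖η (n + 1)‖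
        ≤ 2 ^ (n + 1) * (1 / 4 : ℝ) ^ (n + 1) := by
          gcongr
          · simp
          · exact (hη _).trans (hb (n + 1) n.succ_pos).le
      _ = (1 / 2 : ℝ) ^ (n + 1) := by rw [← mul_pow]; norm_num
  refine Eq.mp ?_ (continuous_tsum_ampRep (ι := ι) x y hx hy)
  congr 1
  ext a
  have hterm : ∀ n, ⟪x n, ampRep ι a (y n)⟫_ℂ = ⟪ζ, ρ a (v n)⟫_ℂ := by
    intro n
    simp only [x, y, map_smul, inner_smul_left, inner_smul_right,
      ContinuousLinearMap.adjoint_inner_left, hUη]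
    rw [← mul_assoc]
    convert one_mul _
    simp [map_ofNat]
  have hs := (summable_inner_of_summable_norm_sq hx (summable_norm_sq_map hy (ampRep ι a))).hasSum
  have hlim := (hs.tendsto_sum_nat).comp (tendsto_add_atTop_nat 1)
  refine tendsto_nhds_unique hlim ?_
  simp only [Function.comp_def, hterm]
  have hc : Continuous fun w => ⟪ζ, ρ a w⟫_ℂ := by fun_prop
  refine ((hc.tendsto ξ).comp hv).congr fun n => ?_
  simp [map_sum]

/-- A representation with ultraweakly continuous coefficients is ultraweakly continuous. -/
theorem isNormalRep_of_normalVectors_eq_top (hι : Function.Injective ι) {e : 𝒜} (he : ι e = 1)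
    (ρ : 𝒜 →⋆ₙₐ[ℂ] (L →L[ℂ] L)) (h : ∀ ξ, ξ ∈ normalVectors ι ρ) : IsNormalRep ι ρ := by
  let _ := (ultraweakTopology H).induced ι
  refine continuous_to_ultraweak.2 fun x y hx hy => ?_
  choose U η hU hη hUη using fun n =>
    exists_intertwiner_of_continuous hι he ρ (ξ := y n) (h (y n) (y n))
  refine (continuous_tsum_ampRep (ι := ι) (fun n => (U n).adjoint (x n)) η ?_ ?_).congr fun a => ?_
  · refine hx.of_nonneg_of_le (fun n => by positivity) fun n => ?_
    gcongr
    refine ((U n).adjoint.le_opNorm _).trans (mul_le_of_le_one_left (norm_nonneg _) ?_)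
    rw [LinearIsometryEquiv.norm_map]
    exact hU n
  · exact hy.of_nonneg_of_le (fun n => by positivity) fun n => by gcongr; exact hη n
  · simp only [ContinuousLinearMap.adjoint_inner_left, hUη]

omit [CompleteSpace K] in
/-- The ampliation of a normal representation along a normal representation is normal: its diagonal
coefficients at the vectors `E x u` are normal, and these vectors are total. -/
theorem IsNormalRep.of_isAmpliation (hι : Function.Injective ι) {e : 𝒜} (he : ι e = 1)
    {E : K → X →L[ℂ] Y} (hE : IsKet E) {π : 𝒜 →⋆ₙₐ[ℂ] (X →L[ℂ] X)} (hπ : IsNormalRep ι π)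
    {φ : 𝒜 → HilbTensor H K →L[ℂ] HilbTensor H K} (hφ : IsNormalRep ι φ)
    {Φ : 𝒜 →⋆ₙₐ[ℂ] (Y →L[ℂ] Y)} (h : ∀ a, IsAmpliation (ketE H) E ι π (φ a) (Φ a)) :
    IsNormalRep ι Φ := by
  let _ := (ultraweakTopology H).induced ι
  refine isNormalRep_of_normalVectors_eq_top hι he Φ ?_
  have hmem : ∀ x u, E x u ∈ normalVectors ι Φ := by
    intro x u
    refine mem_normalVectors_of_continuous hι he Φ ?_
    choose c hc hc' using fun a => h a x x
    have hcont : Continuous c := by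
      let _ := ultraweakTopology H
      let _ := ultraweakTopology (HilbTensor H K)
      refine continuous_induced_rng.2 ?_
      have h1 : ι ∘ c = fun a => (ketE H x).adjoint ∘L φ a ∘L ketE H x := funext hc
      rw [h1]
      exact (continuous_ultraweak_conj (ketE H x) (ketE H x)).comp hφ
    have h2 : Continuous fun a => ⟪u, π (c a) u⟫_ℂ := by
      let _ := ultraweakTopology X
      exact ((continuous_ultraweak_inner u u).comp hπ).comp hcont
    refine h2.congr fun a => ?_
    rw [hc', ContinuousLinearMap.comp_apply, ContinuousLinearMap.adjoint_inner_right]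
    rfl
  have hle : (⨆ x, (E x).range).topologicalClosure ≤ normalVectors ι Φ := by
    refine Submodule.topologicalClosure_minimal _ (iSup_le fun x => ?_)
      (isClosed_normalVectors hι he Φ)
    rintro _ ⟨u, rfl⟩
    exact hmem x u
  rw [hE.dense_span] at hle
  exact fun ξ => hle Submodule.mem_top

/-! ### Ampliation of normal representations -/

/-- Ampliation along a normal representation of an ultraweakly closed algebra is multiplicative:
the slice `E^x T T' E_y` is the ultraweak limit of the sums `∑ E^x T E_i E^i T' E_y`. -/
theorem IsAmpliation.mul_of_isNormalRep {E : K → X →L[ℂ] Y} (hE : IsKet E)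
    (hclosed : @IsClosed _ (ultraweakTopology H) (Set.range ι))
    {π : 𝒜 →⋆ₙₐ[ℂ] (X →L[ℂ] X)} (hπ : IsNormalRep ι π)
    {T T' : HilbTensor H K →L[ℂ] HilbTensor H K} {S S' : Y →L[ℂ] Y}
    (h : IsAmpliation (ketE H) E ι π T S) (h' : IsAmpliation (ketE H) E ι π T' S') :
    IsAmpliation (ketE H) E ι π (T * T') (S * S') := by
  intro x y
  obtain ⟨w, b, -⟩ := exists_hilbertBasis ℂ K
  choose a ha ha' using h
  choose c hc hc' using h'
  let s : Finset w → 𝒜 := fun F => ∑ i ∈ F, a x (b i) * c (b i) y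
  have hs : ∀ F, ι (s F) = (ketE H x).adjoint ∘L (T ∘L ketProj (ketE H) b F ∘L T') ∘L ketE H y := by
    intro F
    ext u
    simp [s, ha, hc, ketProj, map_sum]
  have hs' : ∀ F, π (s F) = (E x).adjoint ∘L (S ∘L ketProj E b F ∘L S') ∘L E y := by
    intro F
    ext u
    simp [s, ha', hc', ketProj, map_sum]
  have hlim : Tendsto (fun F => ι (s F)) atTop (@nhds _ (ultraweakTopology H)
      ((ketE H x).adjoint ∘L (T * T') ∘L ketE H y)) := by
    refine tendsto_ultraweak_of_bounded
      (C := ‖(ketE H x).adjoint‖ * ((‖T‖ * (1 * ‖T'‖)) * ‖ketE H y‖)) (fun F => ?_) fun u v => ?_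
    · rw [hs]
      refine (ContinuousLinearMap.opNorm_comp_le _ _).trans ?_
      gcongr
      refine (ContinuousLinearMap.opNorm_comp_le _ _).trans ?_
      gcongr
      refine (ContinuousLinearMap.opNorm_comp_le _ _).trans ?_
      gcongr
      refine (ContinuousLinearMap.opNorm_comp_le _ _).trans ?_
      gcongr
      exact isKet_ketE.norm_ketProj_le b F
    · have h1 := isKet_ketE.tendsto_ketProj b (T' (ketE H y v))
      have hcont : Continuous fun z => ⟪u, (ketE H x).adjoint (T z)⟫_ℂ := by fun_prop
      refine ((hcont.tendsto _).comp h1).congr fun F => ?_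
      rw [hs]
      rfl
  obtain ⟨d, hd⟩ : (ketE H x).adjoint ∘L (T * T') ∘L ketE H y ∈ Set.range ι := by
    let _ := ultraweakTopology H
    exact hclosed.mem_of_tendsto hlim (Eventually.of_forall fun F => ⟨s F, rfl⟩)
  refine ⟨d, hd, ?_⟩
  have hsd : Tendsto s atTop (@nhds _ ((ultraweakTopology H).induced ι) d) := by
    rw [@nhds_induced _ _ (ultraweakTopology H), tendsto_comap_iff, hd]
    exact hlim
  ext v
  refine ext_inner_left ℂ fun u => ?_
  have h1 : Tendsto (fun F => ⟪u, π (s F) v⟫_ℂ) atTop (𝓝 ⟪u, π d v⟫_ℂ) := by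
    let _ := (ultraweakTopology H).induced ι
    let _ := ultraweakTopology X
    exact (((continuous_ultraweak_inner u v).comp hπ).tendsto d).comp hsd
  refine tendsto_nhds_unique h1 ?_
  have h2 := hE.tendsto_ketProj b (S' (E y v))
  have hcont : Continuous fun z => ⟪u, (E x).adjoint (S z)⟫_ℂ := by fun_prop
  refine ((hcont.tendsto _).comp h2).congr fun F => ?_
  rw [hs']
  rfl

omit [CompleteSpace K] in
theorem opTensor_rankOne (c : H →L[ℂ] H) (x y : K) :
    opTensor c (InnerProductSpace.rankOne ℂ x y) = ketE H x ∘L c ∘L (ketE H y).adjoint := by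
  refine isKet_ketE.ext_comp fun z => ?_
  ext u
  simp [opTensor_ketE, isKet_ketE.adjoint_apply, isKet_ketE.map_smul]

/-- The matrix space over a subspace `V` lies in the ultraweak tensor product `V ⊗ B(K)`: an
operator is the ultraweak limit of its finite corners, which are elements of `V ⊙ B(K)`. -/
theorem matrixSpace_subset_ultraweakTensor {V : Set (H →L[ℂ] H)}
    {T : HilbTensor H K →L[ℂ] HilbTensor H K} (hT : T ∈ matrixSpace K V) :
    T ∈ ultraweakTensor V (Set.univ : Set (K →L[ℂ] K)) := by
  obtain ⟨w, b, -⟩ := exists_hilbertBasis ℂ K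
  have hlim : Tendsto (fun F => ketProj (ketE H) b F ∘L T ∘L ketProj (ketE H) b F) atTop
      (@nhds _ (ultraweakTopology (HilbTensor H K)) T) := by
    refine tendsto_ultraweak_of_bounded (fun F => isKet_ketE.norm_corner_le b F T) fun x y => ?_
    have h1 := (isKet_ketE (H := H) (K := K)).tendsto_ketProj b x
    have h2 := (T.continuous.tendsto _).comp ((isKet_ketE (H := H) (K := K)).tendsto_ketProj b y)
    refine (h1.inner h2).congr fun F => ?_
    rw [ContinuousLinearMap.comp_apply, ContinuousLinearMap.comp_apply,
      ← ContinuousLinearMap.adjoint_inner_left, IsKet.adjoint_ketProj]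
    rfl
  let _ := ultraweakTopology (HilbTensor H K)
  refine mem_closure_of_tendsto hlim (Eventually.of_forall fun F => ?_)
  rw [IsKet.ketProj_comp_comp]
  refine Submodule.sum_mem _ fun i _ => Submodule.sum_mem _ fun j _ => ?_
  rw [← opTensor_rankOne]
  exact Submodule.subset_span ⟨_, hT (b i) (b j), _, trivial, rfl⟩

theorem isClosed_ultraweak_vonNeumannAlgebra (A : VonNeumannAlgebra H) :
    @IsClosed _ (ultraweakTopology H) (A : Set (H →L[ℂ] H)) := by
  let _ := ultraweakTopology H
  have heq : (A : Set (H →L[ℂ] H)) = ⋂ c ∈ Set.centralizer (A : Set (H →L[ℂ] H)), ⋂ z, ⋂ w,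
      {T : H →L[ℂ] H | ⟪c.adjoint z, T w⟫_ℂ = ⟪z, T (c w)⟫_ℂ} := by
    ext T
    nth_rw 1 [← A.centralizer_centralizer]
    simp only [Set.mem_iInter, Set.mem_ofPred_eq, Set.mem_centralizer_iff (S := Set.centralizer _)]
    refine forall₂_congr fun c _ => ⟨fun h z w => ?_, fun h => ?_⟩
    · rw [ContinuousLinearMap.adjoint_inner_left]
      exact congrArg (fun f : H →L[ℂ] H => ⟪z, f w⟫_ℂ) h
    · ext w
      refine ext_inner_left ℂ fun z => ?_
      rw [mul_apply_eq_comp, mul_apply_eq_comp, ← ContinuousLinearMap.adjoint_inner_left]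
      exact h z w
  rw [heq]
  exact isClosed_biInter fun c _ => isClosed_iInter fun z => isClosed_iInter fun w =>
    isClosed_eq (continuous_ultraweak_inner _ _) (continuous_ultraweak_inner _ _)

end Normal

/-! ### Quantum random walks -/

section Walk

variable {𝒜 : Type*} [NonUnitalCStarAlgebra 𝒜] {H K : Type*}
  [NormedAddCommGroup H] [InnerProductSpace ℂ H] [CompleteSpace H]
  [NormedAddCommGroup K] [InnerProductSpace ℂ K] [CompleteSpace K]
  {ι : 𝒜 →⋆ₙₐ[ℂ] (H →L[ℂ] H)}

omit [CompleteSpace H] [CompleteSpace K] in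
theorem ketE_snocTensor (m : ℕ) (x : K) (ξ : TensorPow K m) :
    ketE H (snocTensor m x ξ) = ketEPow H m x ∘L ketE H ξ := by
  ext u
  simp [ketEPow, opTensor_apply_ketE]

omit [CompleteSpace K] in
/-- Ampliation maps into the matrix space over `range ι`: this is clear for the slices at the
vectors `ξ ⊗ x`, which are total. -/
theorem IsAmpliation.mem_matrixSpace (hclosed : IsClosed (Set.range ι)) {m : ℕ}
    {π : 𝒜 →⋆ₙₐ[ℂ] (HilbTensor H (TensorPow K m) →L[ℂ] HilbTensor H (TensorPow K m))}
    (hπ : ∀ a, π a ∈ matrixSpace (TensorPow K m) (Set.range ι))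
    {T : HilbTensor H K →L[ℂ] HilbTensor H K}
    {S : HilbTensor H (TensorPow K (m + 1)) →L[ℂ] HilbTensor H (TensorPow K (m + 1))}
    (h : IsAmpliation (ketE H) (ketEPow H m) ι π T S) :
    S ∈ matrixSpace (TensorPow K (m + 1)) (Set.range ι) := by
  have hket := isKet_ketE (H := H) (K := TensorPow K (m + 1))
  have hcont : Continuous (ketE H : TensorPow K (m + 1) → _) := hket.continuous
  have hleft : ∀ x ξ η, (ketE H (snocTensor m x ξ)).adjoint ∘L S ∘L ketE H η ∈ Set.range ι := by
    intro x ξ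
    let N : Submodule ℂ (TensorPow K (m + 1)) :=
      { carrier := {η | (ketE H (snocTensor m x ξ)).adjoint ∘L S ∘L ketE H η ∈ Set.range ι}
        zero_mem' := ⟨0, by
          have := hket.map_smul 0 0
          rw [zero_smul, zero_smul] at this
          simp [this]⟩
        add_mem' := by
          rintro η η' ⟨a, ha⟩ ⟨a', ha'⟩
          exact ⟨a + a', by simp [ha, ha', hket.map_add]⟩
        smul_mem' := by
          rintro c η ⟨a, ha⟩
          exact ⟨c • a, by simp [ha, hket.map_smul]⟩ }
    have hN : IsClosed (N : Set (TensorPow K (m + 1))) := hclosed.preimage (by fun_prop)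
    have hle : (⨆ y, (snocTensor m y).range).topologicalClosure ≤ N := by
      refine Submodule.topologicalClosure_minimal _ (iSup_le fun y => ?_) hN
      rintro _ ⟨η, rfl⟩
      obtain ⟨a, -, ha⟩ := h x y
      obtain ⟨c, hc⟩ := hπ a ξ η
      refine ⟨c, ?_⟩
      rw [hc, ha]
      change _ = (ketE H (snocTensor m x ξ)).adjoint ∘L S ∘L ketE H (snocTensor m y η)
      rw [ketE_snocTensor, ketE_snocTensor, ContinuousLinearMap.adjoint_comp]
      rfl
    rw [(isKet_snocTensor m).dense_span] at hle
    exact fun η => hle Submodule.mem_top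
  intro ξ η
  let N : Submodule ℂ (TensorPow K (m + 1)) :=
    { carrier := {ξ | (ketE H ξ).adjoint ∘L S ∘L ketE H η ∈ Set.range ι}
      zero_mem' := ⟨0, by
        have := hket.map_smul 0 0
        rw [zero_smul, zero_smul] at this
        simp [this]⟩
      add_mem' := by
        rintro η η' ⟨a, ha⟩ ⟨a', ha'⟩
        exact ⟨a + a', by simp [ha, ha', hket.map_add, ContinuousLinearMap.add_comp]⟩
      smul_mem' := by
        rintro c η ⟨a, ha⟩
        exact ⟨starRingEnd ℂ c • a, by simp [ha, hket.map_smul, map_smulₛₗ]⟩ }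
  have hN : IsClosed (N : Set (TensorPow K (m + 1))) := hclosed.preimage (by fun_prop)
  have hle : (⨆ y, (snocTensor m y).range).topologicalClosure ≤ N := by
    refine Submodule.topologicalClosure_minimal _ (iSup_le fun y => ?_) hN
    rintro _ ⟨ξ, rfl⟩
    exact hleft y ξ η
  rw [(isKet_snocTensor m).dense_span] at hle
  exact hle Submodule.mem_top

omit [CompleteSpace K] in
theorem amplify_mem_matrixSpace (m : ℕ) (a : 𝒜) :
    amplify H (TensorPow K m) (ι a) ∈ matrixSpace (TensorPow K m) (Set.range ι) := fun x y =>
  ⟨⟪x, y⟫_ℂ • a, by rw [amplify_apply, adjoint_opTensor_ketE, map_smul]; rfl⟩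

omit [CompleteSpace K] in
theorem amplify_zero_mem_spatialTensor (a : 𝒜) : amplify H (TensorPow K 0) (ι a) ∈
    spatialTensor (Set.range ι) (spatialPow K 0 : Set (TensorPow K 0 →L[ℂ] TensorPow K 0)) :=
  Submodule.le_topologicalClosure _ (Submodule.subset_span ⟨_, ⟨a, rfl⟩, 1, trivial, rfl⟩)

omit [CompleteSpace K] in
theorem isNormalRep_amplify_zero : IsNormalRep ι ((amplify H (TensorPow K 0)).comp ι) := by
  let _ := (ultraweakTopology H).induced ι
  let _ := ultraweakTopology H
  let _ := ultraweakTopology (HilbTensor H (TensorPow K 0))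
  let b : HilbertBasis PUnit ℂ (EuclideanSpace ℂ PUnit) :=
    (EuclideanSpace.basisFun PUnit ℂ).toHilbertBasis
  have h : Continuous (amplify H (TensorPow K 0)) :=
    continuous_ultraweak_amplify (K := TensorPow K 0) b
  exact h.comp continuous_induced_dom

omit [CompleteSpace K] in
/-- Iteration of ampliation along `φ`, starting from `a ↦ a ⊗ 1` on `H ⊗ ℂ`, and preserving a
property `P`. -/
theorem exists_seq_isAmpliation {φ : 𝒜 → HilbTensor H K →L[ℂ] HilbTensor H K}
    {P : (m : ℕ) →
      (𝒜 →⋆ₙₐ[ℂ] (HilbTensor H (TensorPow K m) →L[ℂ] HilbTensor H (TensorPow K m))) → Prop}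
    (h0 : P 0 ((amplify H (TensorPow K 0)).comp ι))
    (hstep : ∀ m π, P m π →
      ∃ π', P (m + 1) π' ∧ ∀ a, IsAmpliation (ketE H) (ketEPow H m) ι π (φ a) (π' a)) :
    ∃ Φ : (m : ℕ) →
        (𝒜 →⋆ₙₐ[ℂ] (HilbTensor H (TensorPow K m) →L[ℂ] HilbTensor H (TensorPow K m))),
      Φ 0 = (amplify H (TensorPow K 0)).comp ι ∧ (∀ m, P m (Φ m)) ∧
      ∀ m a, IsAmpliation (ketE H) (ketEPow H m) ι (Φ m) (φ a) (Φ (m + 1) a) := by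
  choose f hf hf' using hstep
  let Φ : (m : ℕ) → {π // P m π} := fun m =>
    Nat.rec ⟨_, h0⟩ (fun m π => ⟨f m π.1 π.2, hf m π.1 π.2⟩) m
  exact ⟨fun m => (Φ m).1, rfl, fun m => (Φ m).2, fun m => hf' m (Φ m).1 (Φ m).2⟩

/-- The walk generated by a `*`-homomorphism with values in the spatial tensor product. -/
theorem exists_seq_of_mem_spatialTensor (hι : Function.Injective ι)
    (hclosed : IsClosed (Set.range ι))
    (φ : 𝒜 →⋆ₙₐ[ℂ] (HilbTensor H K →L[ℂ] HilbTensor H K))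
    (hφ : ∀ a, φ a ∈ spatialTensor (Set.range ι) Set.univ)
    (hφ' : ∀ a, φ a ∈ matrixSpace K (Set.range ι)) :
    ∃ Φ : (m : ℕ) →
        (𝒜 →⋆ₙₐ[ℂ] (HilbTensor H (TensorPow K m) →L[ℂ] HilbTensor H (TensorPow K m))),
      Φ 0 = (amplify H (TensorPow K 0)).comp ι ∧
      (∀ m, (∀ a, Φ m a ∈ matrixSpace (TensorPow K m) (Set.range ι)) ∧
        ∀ a, Φ m a ∈ spatialTensor (Set.range ι)
          (spatialPow K m : Set (TensorPow K m →L[ℂ] TensorPow K m))) ∧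
      ∀ m a, IsAmpliation (ketE H) (ketEPow H m) ι (Φ m) (φ a) (Φ (m + 1) a) := by
  refine exists_seq_isAmpliation (P := fun m π =>
      (∀ a, π a ∈ matrixSpace (TensorPow K m) (Set.range ι)) ∧
        ∀ a, π a ∈ spatialTensor (Set.range ι)
          (spatialPow K m : Set (TensorPow K m →L[ℂ] TensorPow K m)))
    ⟨amplify_mem_matrixSpace 0, amplify_zero_mem_spatialTensor⟩ fun m π hπ => ?_
  obtain ⟨Φ, hΦ⟩ := IsAmpliation.exists_hom (π := π) (isKet_ketEPow m) hι φ hφ'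
    fun a a' S S' h h' => h.mul_of_mem_spatialTensor (isKet_ketEPow m) hι (hφ a) h'
  exact ⟨Φ, ⟨fun a => (hΦ a).mem_matrixSpace hclosed hπ.1,
    fun a => (hΦ a).mem_spatialTensor hι hπ.2 (hφ a)⟩, hΦ⟩

/-- The walk generated by a normal `*`-homomorphism of an ultraweakly closed algebra. -/
theorem exists_seq_of_isNormalRep (hι : Function.Injective ι) {e : 𝒜} (he : ι e = 1)
    (hclosed : IsClosed (Set.range ι))
    (hclosed' : @IsClosed _ (ultraweakTopology H) (Set.range ι))
    (φ : 𝒜 →⋆ₙₐ[ℂ] (HilbTensor H K →L[ℂ] HilbTensor H K))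
    (hφ : ∀ a, φ a ∈ matrixSpace K (Set.range ι)) (hφn : IsNormalRep ι φ) :
    ∃ Φ : (m : ℕ) →
        (𝒜 →⋆ₙₐ[ℂ] (HilbTensor H (TensorPow K m) →L[ℂ] HilbTensor H (TensorPow K m))),
      Φ 0 = (amplify H (TensorPow K 0)).comp ι ∧
      (∀ m, (∀ a, Φ m a ∈ matrixSpace (TensorPow K m) (Set.range ι)) ∧ IsNormalRep ι (Φ m)) ∧
      ∀ m a, IsAmpliation (ketE H) (ketEPow H m) ι (Φ m) (φ a) (Φ (m + 1) a) := by
  refine exists_seq_isAmpliation (P := fun m π =>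
      (∀ a, π a ∈ matrixSpace (TensorPow K m) (Set.range ι)) ∧ IsNormalRep ι π)
    ⟨amplify_mem_matrixSpace 0, isNormalRep_amplify_zero⟩ fun m π hπ => ?_
  obtain ⟨Φ, hΦ⟩ := IsAmpliation.exists_hom (π := π) (isKet_ketEPow m) hι φ hφ
    fun a a' S S' h h' => h.mul_of_isNormalRep (isKet_ketEPow m) hclosed' hπ.2 h'
  exact ⟨Φ, ⟨fun a => (hΦ a).mem_matrixSpace hclosed hπ.1,
    .of_isAmpliation hι he (isKet_ketEPow m) hπ.2 hφn hΦ⟩, hΦ⟩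

variable {S : Type*} [SetLike S (H →L[ℂ] H)] {V : S}

omit [CompleteSpace K] in
/-- A family of maps that starts with `a ↦ a ⊗ 1` and in which each is the ampliation of `φ` along
its predecessor is the quantum random walk generated by `φ`. -/
theorem IsQuantumRandomWalk.of_isAmpliation [NonUnitalCStarAlgebra V]
    {ι : V →⋆ₙₐ[ℂ] (H →L[ℂ] H)} (hι : ∀ a, ι a = a)
    {φ : V → matrixSpace K (V : Set (H →L[ℂ] H))}
    {Φ : (m : ℕ) →
      (V →⋆ₙₐ[ℂ] (HilbTensor H (TensorPow K m) →L[ℂ] HilbTensor H (TensorPow K m)))}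
    (h0 : Φ 0 = (amplify H (TensorPow K 0)).comp ι)
    (hmem : ∀ m a, Φ m a ∈ matrixSpace (TensorPow K m) (V : Set (H →L[ℂ] H)))
    (hΦ : ∀ m a, IsAmpliation (ketE H) (ketEPow H m) ι (Φ m) (φ a : HilbTensor H K →L[ℂ] _)
      (Φ (m + 1) a)) :
    IsQuantumRandomWalk V φ fun m => Φ m where
  mem := hmem
  zero a := by rw [h0, ← hι a]; rfl
  succ m a x y := by
    obtain ⟨c, hc, hc'⟩ := hΦ m a x y
    rw [← hc']
    congr 1
    exact Subtype.ext ((hι c).symm.trans hc)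

omit [CompleteSpace K] in
theorem IsQuantumRandomWalk.unique {φ : V → matrixSpace K (V : Set (H →L[ℂ] H))}
    {Φ Ψ : (m : ℕ) → V → (HilbTensor H (TensorPow K m) →L[ℂ] HilbTensor H (TensorPow K m))}
    (hΦ : IsQuantumRandomWalk V φ Φ) (hΨ : IsQuantumRandomWalk V φ Ψ) (m : ℕ) (a : V) :
    Φ m a = Ψ m a := by
  induction m generalizing a with
  | zero => rw [hΦ.zero, hΨ.zero]
  | succ m ih =>
    refine (isKet_ketEPow m).ext_op fun x y => ?_
    rw [hΦ.succ, hΨ.succ, ih]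

end Walk

end

theorem mainTheorem12 {H K : Type*}
    [NormedAddCommGroup H] [InnerProductSpace ℂ H] [CompleteSpace H]
    [NormedAddCommGroup K] [InnerProductSpace ℂ K] [CompleteSpace K] :
    (∀ (A : NonUnitalStarSubalgebra ℂ (H →L[ℂ] H)) (hA : IsClosed (A : Set (H →L[ℂ] H)))
      (φ : A →⋆ₙₐ[ℂ] (HilbTensor H K →L[ℂ] HilbTensor H K))
      (hφ : ∀ a, φ a ∈ spatialTensor (A : Set (H →L[ℂ] H)) (Set.univ : Set (K →L[ℂ] K))),
      ∃ Φ : (m : ℕ) →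
          (A →⋆ₙₐ[ℂ] (HilbTensor H (TensorPow K m) →L[ℂ] HilbTensor H (TensorPow K m))),
        IsQuantumRandomWalk A
          (fun a => ⟨φ a, spatialTensor_subset_matrixSpace A hA (hφ a)⟩) (fun m => Φ m) ∧
        (∀ Ψ, IsQuantumRandomWalk A
          (fun a => ⟨φ a, spatialTensor_subset_matrixSpace A hA (hφ a)⟩) Ψ →
            ∀ m a, Ψ m a = Φ m a) ∧
        ∀ m, (∀ a, Φ m a ∈ spatialTensor (A : Set (H →L[ℂ] H))
            (spatialPow K m : Set (TensorPow K m →L[ℂ] TensorPow K m))) ∧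
          IsCompletelyBounded A (Φ m)) ∧
    (∀ (A : VonNeumannAlgebra H)
      (φ : A.toStarSubalgebra →⋆ₙₐ[ℂ] (HilbTensor H K →L[ℂ] HilbTensor H K))
      (hφ : ∀ a, φ a ∈ ultraweakTensor (A : Set (H →L[ℂ] H)) (Set.univ : Set (K →L[ℂ] K)))
      (_ : IsNormalMap A.toStarSubalgebra φ),
      ∃ Φ : (m : ℕ) → (A.toStarSubalgebra →⋆ₙₐ[ℂ]
          (HilbTensor H (TensorPow K m) →L[ℂ] HilbTensor H (TensorPow K m))),
        IsQuantumRandomWalk A.toStarSubalgebra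
          (fun a => ⟨φ a, ultraweakTensor_subset_matrixSpace A (hφ a)⟩) (fun m => Φ m) ∧
        (∀ Ψ, IsQuantumRandomWalk A.toStarSubalgebra
          (fun a => ⟨φ a, ultraweakTensor_subset_matrixSpace A (hφ a)⟩) Ψ →
            ∀ m a, Ψ m a = Φ m a) ∧
        ∀ m, (∀ a, Φ m a ∈ ultraweakTensor (A : Set (H →L[ℂ] H))
            (Set.univ : Set (TensorPow K m →L[ℂ] TensorPow K m))) ∧
          IsNormalMap A.toStarSubalgebra (Φ m) ∧
          IsCompletelyBounded A.toStarSubalgebra (Φ m)) := by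
  constructor
  · intro A hA φ hφ
    have := hA
    let ι := NonUnitalStarSubalgebraClass.subtype A
    have hr : Set.range ι = A := Subtype.range_coe
    obtain ⟨Φ, h0, hP, hΦ⟩ := exists_seq_of_mem_spatialTensor (ι := ι) Subtype.val_injective
      (by rw [hr]; exact hA) φ (by rw [hr]; exact hφ)
      (by rw [hr]; exact fun a => spatialTensor_subset_matrixSpace A hA (hφ a))
    rw [hr] at hP
    have hwalk : IsQuantumRandomWalk A
        (fun a => ⟨φ a, spatialTensor_subset_matrixSpace A hA (hφ a)⟩) (fun m => Φ m) :=
      .of_isAmpliation (ι := ι) (fun _ => rfl) h0 (fun m => (hP m).1) hΦ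
    refine ⟨Φ, hwalk, fun Ψ hΨ m a => hΨ.unique hwalk m a, fun m => ⟨(hP m).2, 1, ?_⟩⟩
    intro n k a b
    rw [one_mul]
    exact norm_sum_opTensor_le (ι := ι) Subtype.val_injective (Φ m) Finset.univ a b
  · intro A φ hφ hφn
    have hA : IsClosed (A.toStarSubalgebra : Set (H →L[ℂ] H)) := by
      have h := Set.isClosed_centralizer (Set.centralizer (A : Set (H →L[ℂ] H)))
      rw [A.centralizer_centralizer] at h
      exact h
    let ι := NonUnitalStarSubalgebraClass.subtype A.toStarSubalgebra
    have hr : Set.range ι = A := Subtype.range_coe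
    obtain ⟨Φ, h0, hP, hΦ⟩ := exists_seq_of_isNormalRep (ι := ι) Subtype.val_injective
      (e := (1 : A.toStarSubalgebra)) rfl (by rw [hr]; exact hA)
      (by rw [hr]; exact isClosed_ultraweak_vonNeumannAlgebra A) φ
      (by rw [hr]; exact fun a => ultraweakTensor_subset_matrixSpace A (hφ a)) hφn
    rw [hr] at hP
    have hwalk : IsQuantumRandomWalk A.toStarSubalgebra
        (fun a => ⟨φ a, ultraweakTensor_subset_matrixSpace A (hφ a)⟩) (fun m => Φ m) :=
      .of_isAmpliation (ι := ι) (fun _ => rfl) h0 (fun m => (hP m).1) hΦ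
    refine ⟨Φ, hwalk, fun Ψ hΨ m a => hΨ.unique hwalk m a, fun m =>
      ⟨fun a => matrixSpace_subset_ultraweakTensor ((hP m).1 a), (hP m).2, 1, ?_⟩⟩
    intro n k a b
    rw [one_mul]
    exact norm_sum_opTensor_le (ι := ι) Subtype.val_injective (Φ m) Finset.univ a b
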